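/- Let $(\mathcal P,d,\mu)$ be a metric measure space whose measure $\mu$ is Borel regular, non-atomic and doubling (there is $c$ with $\mu(2B)\le c\,\mu(B)$ for all balls $B$), and such that every ball has finite positive measure. All functions are extended real-valued and defined everywhere on $\mathcal P$; "measurable" means $\mu$-measurable, and $\fint_E$ denotes the integral mean over $E$. **Upper gradients, Poincaré inequality.** A Borel function $g:\mathcal P\to[0,\infty]$ is an *upper gradient* of $u:\mathcal P\to[-\infty,\infty]$ if $|u(\gamma(0))-u(\gamma(l_\gamma))|\le\int_\gamma g\,ds$ for every non-constant rectifiable curve $\gamma:[0,l_\gamma]\to\mathcal P$ parametrized by arc length (with $|(\pm\infty)-(\pm\infty)|=\infty$). For $p\in[1,\infty)$, $\mathcal P$ is a *$p$-Poincaré space* if there are $c>0$, $\lambda\ge1$ such that for all balls $B$, all $u$ integrable on balls and all upper gradients $g$ of $u$, $$\fint_B|u-u_B|\,d\mu\le c\,\mathrm{diam}(B)\Bigl(\fint_{\lambda B}g^p\,d\mu\Bigr)^{1/p},\qquad u_B=\fint_B u\,d\mu .$$ **R.i. spaces.** Let $X=\{u \text{ measurable}:\|u\|_X<\infty\}$ be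 a rearrangement-invariant Banach function space over $(\mathcal P,\mu)$: $\|\cdot\|_X$ is a norm (functions equal a.e. being identified); $|u|\le|v|$ a.e. implies $\|u\|_X\le\|v\|_X$; $0\le u_n\uparrow u$ a.e. implies $\|u_n\|_X\uparrow\|u\|_X$; for every measurable $E$ with $\mu(E)<\infty$, $\|\chi_E\|_X<\infty$ and $\int_E|u|\,d\mu\le C_E\|u\|_X$ for all measurable $u$; and $\|u\|_X=\|v\|_X$ if $\mu\{|u|>t\}=\mu\{|v|>t\}$ for all $t\ge0$. Its norm is *absolutely continuous* if $\|u\chi_{E_n}\|_X\to0$ for every $u\in X$ and every decreasing sequence of measurable sets $E_n$ with $\mu(\bigcap_nE_n)=0$. The *fundamental function* of $X$ is $\phi(t)=\|\chi_E\|_X$ with any measurable $E$ of measure $t$ if $0\le t<\mu(\mathcal P)$, and $\phi(t)=\|1\|_X$ if $t\ge\mu(\mathcal P)$. **Newtonian space.** $\|u\|_{N^1X}=\|u\|_X+\inf_g\|g\|_X$, the infimum being over all upper gradients $g$ of $u$, and $N^1X$ is the set of measurable $u$ with $\|u\|_{N^1X}<\infty$. **Notation.** Let $u^*(t)=\inf\{s\ge0:\mu\{|u|>s\}\le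 t\}$ (similarly for functions on $(0,\infty)$ with Lebesgue measure), and let $M_pf(t)=\sup_{B\ni t}(\fint_B|f|^p)^{1/p}$ be the non-centered maximal operator on $(0,\infty)$. Put $$\|u\|_{M^p_{\rm loc}(X)}=\sup_{0<t<1}M_pu^*(t)\,\phi(t),\qquad \|u\|_{\Lambda^p_\psi}=\Bigl(\int_0^\infty(u^*(t)\psi(t))^p\frac{dt}t\Bigr)^{1/p},\qquad \|u\|_{L^{p,1}}=\frac1p\int_0^\infty u^*(t)t^{1/p}\frac{dt}t,$$ where $\psi(0)=0$, $\psi(t)=t^{1/p}\sup_{t\le s\le1}\phi(s)s^{-1/p}$ for $0<t\le1$ and $\psi(t)=\phi(t)$ for $t\ge1$. Write $A\hookrightarrow B$ if $\|u\|_B\le c\|u\|_A$ for all $u\in A$ with some constant $c$, and $A\hookrightarrow B_{\rm fm}$ if for every measurable $E$ with $\mu(E)<\infty$ there is $c_E$ with $\|u\chi_E\|_B\le c_E\|u\|_A$ for all $u\in A$. Let $\overline X$ be the representation space of $X$, i.e. the r.i. space over $(0,\infty)$ with Lebesgue measure determined by $\|u\|_X=\|u^*\|_{\overline X}$ for all measurable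 $u$ on $\mathcal P$ and $\|f\|_{\overline X}=\|f^*\chi_{(0,\mu(\mathcal P))}\|_{\overline X}$, and let $E_{1/s}f(t)=f(t/s)$. The upper Boyd and the upper fundamental (Zippin) index of $X$ are $$\overline\alpha_X=\inf_{s>1}\frac{\log h_X(s)}{\log s},\quad \overline\beta_X=\inf_{s>1}\frac{\log k_X(s)}{\log s},\qquad h_X(s)=\sup_{0\ne f\in\overline X}\frac{\|E_{1/s}f\|_{\overline X}}{\|f\|_{\overline X}},\quad k_X(s)=\sup_{t>0}\frac{\phi(st)}{\phi(t)} .$$ **Theorem.** Assume that $\mathcal P$ is a $p$-Poincaré space for some $p\in[1,\infty)$ and that $X$ is an r.i. space with absolutely continuous norm and fundamental function $\phi$. Suppose that any one of the following conditions is satisfied: 1. $X\hookrightarrow M^p_{\rm loc}(X)$; 2. $X\hookrightarrow\Lambda^p_{\psi,{\rm fm}}$; 3. $L^{p,1}(\mathcal P)\hookrightarrow X_{\rm fm}$ and $X\hookrightarrow L^p_{\rm fm}(\mathcal P)$; 4. $\phi(t)^p\fint_0^t\phi(s)^{-p}\,ds$ is bounded on $(0,\delta)$ for some $\delta>0$;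 5. $\phi^q$ is concave on $[0,\delta)$ for some $q>p$ and some $\delta>0$; 6. $\phi(t)^q/t$ is non-increasing on $(0,\delta)$ for some $q>p$ and some $\delta>0$; 7. $m_\phi\in L^p(0,1)$, where $m_\phi(s)=\sup_{0<t<1}\phi(t)/\phi(st)$; 8. $\overline\beta_X<1/p$; 9. $\overline\alpha_X<1/p$. Then Lipschitz functions are dense in $N^1X$: for every $u\in N^1X$ and $\varepsilon>0$ there is a Lipschitz function $v:\mathcal P\to\mathbb R$ in $N^1X$ with $\|u-v\|_{N^1X}<\varepsilon$. -/

import Mathlib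

open MeasureTheory Set Filter Topology
open scoped ENNReal NNReal

noncomputable section

/-! ### Rearrangement-invariant spaces -/

/-- A rearrangement-invariant Banach function space over `(α, μ)`, given by its function norm on
non-negative `μ`-measurable functions. An extended real-valued `μ`-measurable `u` has the norm
`‖u‖_X = X |u|` and lies in `X` iff that is finite. As `μ`-measurability refers to the completion
of `μ`, it is expressed by `AEMeasurable` and `NullMeasurableSet`; values at non-measurable
functions are irrelevant. -/
structure RISpace {α : Type*} [MeasurableSpace α] (μ : Measure α) where
  toFun : (α → ℝ≥0∞) → ℝ≥0∞
  eq_zero_iff : ∀ f, AEMeasurable f μ → (toFun f = 0 ↔ f =ᵐ[μ] 0)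
  smul : ∀ (a : ℝ≥0) (f), AEMeasurable f μ → toFun (fun x => a * f x) = a * toFun f
  add_le : ∀ f g, AEMeasurable f μ → AEMeasurable g μ →
    toFun (fun x => f x + g x) ≤ toFun f + toFun g
  mono : ∀ f g, AEMeasurable f μ → AEMeasurable g μ → f ≤ᵐ[μ] g → toFun f ≤ toFun g
  /-- Fatou property. -/
  fatou : ∀ f : ℕ → α → ℝ≥0∞, (∀ n, AEMeasurable (f n) μ) →
    (∀ᵐ x ∂μ, Monotone fun n => f n x) → toFun (fun x => ⨆ n, f n x) = ⨆ n, toFun (f n)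
  indicator_lt_top : ∀ E, NullMeasurableSet E μ → μ E < ∞ → toFun (E.indicator 1) < ∞
  lintegral_le : ∀ E, NullMeasurableSet E μ → μ E < ∞ →
    ∃ C : ℝ≥0, ∀ f, AEMeasurable f μ → ∫⁻ x in E, f x ∂μ ≤ C * toFun f
  /-- Equimeasurable functions have the same norm. -/
  rearrangement_invariant : ∀ f g, AEMeasurable f μ → AEMeasurable g μ →
    (∀ t : ℝ≥0, μ {x | (t : ℝ≥0∞) < f x} = μ {x | (t : ℝ≥0∞) < g x}) → toFun f = toFun g

instance {α : Type*} [MeasurableSpace α] (μ : Measure α) :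
    CoeFun (RISpace μ) fun _ => (α → ℝ≥0∞) → ℝ≥0∞ := ⟨RISpace.toFun⟩

/-- Absolute continuity of the norm. -/
def RISpace.HasACNorm {α : Type*} [MeasurableSpace α] {μ : Measure α} (X : RISpace μ) : Prop :=
  ∀ f, AEMeasurable f μ → X f < ∞ → ∀ E : ℕ → Set α, (∀ n, NullMeasurableSet (E n) μ) →
    Antitone E → μ (⋂ n, E n) = 0 → Tendsto (fun n => X ((E n).indicator f)) atTop (𝓝 0)

/-- The fundamental function `φ(t) = ‖χ_E‖_X` with `μ E = t` for `0 ≤ t < μ α`, and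
`φ(t) = ‖1‖_X` for `t ≥ μ α`. All sets of the same measure yield the same value. -/
def RISpace.fundamental {α : Type*} [MeasurableSpace α] {μ : Measure α} (X : RISpace μ)
    (t : ℝ) : ℝ≥0∞ :=
  if ENNReal.ofReal t < μ univ then
    ⨆ (E : Set α) (_ : NullMeasurableSet E μ) (_ : μ E = ENNReal.ofReal t), X (E.indicator 1)
  else X 1

/-- The decreasing rearrangement `f^*(t) = inf {s ≥ 0 : μ {f > s} ≤ t}`, for `t ≥ 0`. -/
def rearr {α : Type*} [MeasurableSpace α] (μ : Measure α) (f : α → ℝ≥0∞) (t : ℝ) : ℝ≥0∞ :=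
  sInf {s : ℝ≥0∞ | μ {x | s < f x} ≤ ENNReal.ofReal t}

/-- `(0, ∞)` as a metric space. -/
abbrev RPos : Type := {t : ℝ // 0 < t}

/-- The Lebesgue measure on `(0, ∞)`. -/
def volRPos : Measure RPos := Measure.comap Subtype.val (volume : Measure ℝ)

/-- The norm of the representation space of `X` over `(0, ∞)`: it is determined by
`‖u‖_X = ‖u^*‖` for `u` on `α`, and `‖f‖ = ‖f^* χ_(0, μ α)‖` for `f` on `(0, ∞)`. The infimum is
over a set of `u` on which `‖u‖_X` is constant. -/
def RISpace.reprNorm {α : Type*} [MeasurableSpace α] {μ : Measure α} (X : RISpace μ)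
    (f : RPos → ℝ≥0∞) : ℝ≥0∞ :=
  ⨅ (u : α → ℝ≥0∞) (_ : AEMeasurable u μ)
    (_ : ∀ t : RPos, rearr μ u t =
      if ENNReal.ofReal t < μ univ then rearr volRPos f t else 0), X u

/-- The dilation operator `E_s f(t) = f(s t)`. -/
def dilation (s : RPos) (f : RPos → ℝ≥0∞) : RPos → ℝ≥0∞ := fun t => f (s * t)

/-- `h_X(s) = sup ‖E_{1/s} f‖ / ‖f‖` over the non-zero elements `f` of the representation space. -/
def RISpace.dilationNorm {α : Type*} [MeasurableSpace α] {μ : Measure α} (X : RISpace μ)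
    (s : RPos) : ℝ≥0∞ :=
  ⨆ (f : RPos → ℝ≥0∞) (_ : AEMeasurable f volRPos)
    (_ : X.reprNorm f ≠ 0) (_ : X.reprNorm f < ∞), X.reprNorm (dilation s⁻¹ f) / X.reprNorm f

/-- The upper Boyd index. -/
def RISpace.upperBoydIndex {α : Type*} [MeasurableSpace α] {μ : Measure α} (X : RISpace μ) :
    EReal :=
  ⨅ (s : RPos) (_ : 1 < (s : ℝ)), ENNReal.log (X.dilationNorm s) / (Real.log s : EReal)

/-- The upper fundamental (Zippin) index, with `k_X(s) = sup_{t > 0} φ(st) / φ(t)`. -/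
def RISpace.upperFundamentalIndex {α : Type*} [MeasurableSpace α] {μ : Measure α}
    (X : RISpace μ) : EReal :=
  ⨅ (s : ℝ) (_ : 1 < s),
    ENNReal.log (⨆ (t : ℝ) (_ : 0 < t), X.fundamental (s * t) / X.fundamental t) /
      (Real.log s : EReal)

/-! ### Maximal operator, Marcinkiewicz and Lorentz norms, embeddings -/

/-- The non-centered maximal operator `M_p`. -/
def maximalOp {R : Type*} [PseudoMetricSpace R] [MeasurableSpace R] (ν : Measure R) (p : ℝ)
    (f : R → ℝ≥0∞) (x : R) : ℝ≥0∞ :=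
  ⨆ (c : R) (r : ℝ) (_ : x ∈ Metric.ball c r), (⨍⁻ y in Metric.ball c r, f y ^ p ∂ν) ^ (1 / p)

/-- `‖f‖ = sup_{0<t<1} M_p f^*(t) φ(t)`, the norm of `M^p_{φ,loc}`. -/
def marcinkiewiczLocNorm {α : Type*} [MeasurableSpace α] (μ : Measure α) (p : ℝ)
    (φ : ℝ → ℝ≥0∞) (f : α → ℝ≥0∞) : ℝ≥0∞ :=
  ⨆ (t : RPos) (_ : (t : ℝ) < 1),
    maximalOp volRPos p (fun s => rearr μ f s) t * φ t

/-- `‖f‖ = (∫_0^∞ (f^*(t) ψ(t))^q dt/t)^{1/q}`, the norm of `Λ^q_ψ`. -/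
def lambdaNorm {α : Type*} [MeasurableSpace α] (μ : Measure α) (q : ℝ) (ψ : ℝ → ℝ≥0∞)
    (f : α → ℝ≥0∞) : ℝ≥0∞ :=
  (∫⁻ t in Ioi (0 : ℝ), (rearr μ f t * ψ t) ^ q / ENNReal.ofReal t) ^ (1 / q)

/-- `‖f‖ = ((q/p) ∫_0^∞ (f^*(t) t^{1/p})^q dt/t)^{1/q}`, the norm of `L^{p,q}`, `q < ∞`. -/
def lorentzNorm {α : Type*} [MeasurableSpace α] (μ : Measure α) (p q : ℝ)
    (f : α → ℝ≥0∞) : ℝ≥0∞ :=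
  (ENNReal.ofReal (q / p) *
    ∫⁻ t in Ioi (0 : ℝ), (rearr μ f t * ENNReal.ofReal t ^ (1 / p)) ^ q / ENNReal.ofReal t)
      ^ (1 / q)

/-- `ψ(t) = t^{1/p} sup_{t ≤ s ≤ 1} φ(s) / s^{1/p}` for `0 < t ≤ 1`, `ψ(0) = 0`, and
`ψ(t) = φ(t)` for `t ≥ 1`. -/
def quasiconcaveMajorant (p : ℝ) (φ : ℝ → ℝ≥0∞) (t : ℝ) : ℝ≥0∞ :=
  if t ≤ 0 then 0
  else if t ≤ 1 then
    ENNReal.ofReal t ^ (1 / p) * ⨆ s ∈ Icc t 1, φ s / ENNReal.ofReal s ^ (1 / p)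
  else φ t

/-- `A ↪ B` for function spaces given by their norms. -/
def Embeds {α : Type*} [MeasurableSpace α] (μ : Measure α)
    (A B : (α → ℝ≥0∞) → ℝ≥0∞) : Prop :=
  ∃ c : ℝ≥0, ∀ f, AEMeasurable f μ → A f < ∞ → B f ≤ c * A f

/-- `A ↪ B_fm`: continuous embedding on sets of finite measure. -/
def EmbedsFm {α : Type*} [MeasurableSpace α] (μ : Measure α)
    (A B : (α → ℝ≥0∞) → ℝ≥0∞) : Prop :=
  ∀ E, NullMeasurableSet E μ → μ E < ∞ →
    ∃ c : ℝ≥0, ∀ f, AEMeasurable f μ → A f < ∞ → B (E.indicator f) ≤ c * A f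

/-! ### Metric measure spaces, upper gradients, Newtonian spaces -/

/-- Every ball has finite positive measure. -/
def BallsFinitePos {P : Type*} [PseudoMetricSpace P] [MeasurableSpace P] (μ : Measure P) : Prop :=
  ∀ (x : P) (r : ℝ), 0 < r → 0 < μ (Metric.ball x r) ∧ μ (Metric.ball x r) < ∞

def IsDoubling {P : Type*} [PseudoMetricSpace P] [MeasurableSpace P] (μ : Measure P) : Prop :=
  ∃ C : ℝ≥0, ∀ (x : P) (r : ℝ), 0 < r → μ (Metric.ball x (2 * r)) ≤ C * μ (Metric.ball x r)

/-- `g` is an upper gradient of `u`. Curves are non-constant, rectifiable, and parametrized by arc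
length on `[0, l]`. In `EReal`, `|(±∞) - (±∞)| = ∞` as required. -/
def IsUpperGradient {P : Type*} [PseudoMetricSpace P] [MeasurableSpace P]
    (u : P → EReal) (g : P → ℝ≥0∞) : Prop :=
  Measurable g ∧ ∀ (γ : ℝ → P) (l : ℝ), 0 < l → HasUnitSpeedOn γ (Icc 0 l) →
    (u (γ 0) - u (γ l)).abs ≤ ∫⁻ t in Icc 0 l, g (γ t)

/-- The `p`-Poincaré inequality. -/
def IsPoincareSpace {P : Type*} [PseudoMetricSpace P] [MeasurableSpace P] (μ : Measure P)
    (p : ℝ) : Prop :=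
  ∃ (c : ℝ≥0) (l : ℝ), 0 < c ∧ 1 ≤ l ∧ ∀ (x : P) (r : ℝ), 0 < r →
    ∀ u : P → ℝ, (∀ (y : P) (R : ℝ), IntegrableOn u (Metric.ball y R) μ) →
    ∀ g : P → ℝ≥0∞, IsUpperGradient (fun y => (u y : EReal)) g →
      ⨍⁻ y in Metric.ball x r, ‖u y - ⨍ z in Metric.ball x r, u z ∂μ‖ₑ ∂μ ≤
        c * ENNReal.ofReal (Metric.diam (Metric.ball x r)) *
          (⨍⁻ y in Metric.ball x (l * r), g y ^ p ∂μ) ^ (1 / p)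

/-- `‖u‖_{N¹X} = ‖u‖_X + inf_g ‖g‖_X`, the infimum being over all upper gradients `g` of `u`. -/
def newtonianNorm {P : Type*} [PseudoMetricSpace P] [MeasurableSpace P] {μ : Measure P}
    (X : RISpace μ) (u : P → EReal) : ℝ≥0∞ :=
  X (fun x => (u x).abs) + ⨅ (g : P → ℝ≥0∞) (_ : IsUpperGradient u g), X g

/-- `u ∈ N¹X`. -/
def MemNewtonian {P : Type*} [PseudoMetricSpace P] [MeasurableSpace P] {μ : Measure P}
    (X : RISpace μ) (u : P → EReal) : Prop :=
  AEMeasurable u μ ∧ newtonianNorm X u < ∞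

/-- Lipschitz functions are dense in `N¹X`. -/
def LipschitzDenseInNewtonian {P : Type*} [PseudoMetricSpace P] [MeasurableSpace P]
    {μ : Measure P} (X : RISpace μ) : Prop :=
  ∀ u : P → EReal, MemNewtonian X u → ∀ ε : ℝ≥0∞, 0 < ε →
    ∃ v : P → ℝ, (∃ K : ℝ≥0, LipschitzWith K v) ∧ MemNewtonian X (fun x => (v x : EReal)) ∧
      newtonianNorm X (fun x => u x - (v x : EReal)) < ε

end

/-! The common core of the nine conditions is `RISpace.ControlsLpMean`: if `f` vanishes off a set
`E` of small measure, then `φ(μ E) (⨍_E f^p)^{1/p} ≤ c ‖f‖_X`. Density then follows by approximating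
off the set where a maximal function is large.

Absolute continuity of the norm lets `u` be truncated, so `u` may be taken real and bounded, with an
upper gradient `g ∈ X`. Put `f_n = g χ_{g > n}`, and let `A_n` contain `{g > n}` and all centres of
balls on which the mean of `f_n^p` exceeds `n^p`. The weak type estimate
(`mul_measure_le_lintegral_of_maximal`) gives `n μ(A_n)^{1/p} ≤ C ‖f_n‖_p`. Applying the core
property to `f_n` on `E = A_n` turns this into `n ‖χ_{A_n}‖_X ≤ C ‖f_n‖_X`, which tends to `0`.

Off `A_n` all ball means of `g^p` are at most `(2n)^p`, so the Poincaré inequality and telescoping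
over shrinking balls make `u` Lipschitz there, with constant of order `n`, up to a null set
(`abs_sub_le_of_oscillation`). The McShane extension `v`, cut at the bounds of `u`, agrees with `u`
off a set `A` of the same measure as `A_n`. By `IsUpperGradient.indicator_add` the upper gradient of
`u - v` can be cut off to `A`, at the price of an extra small multiple of `g`. Its norm is then at
most `‖g χ_A‖ + C n ‖χ_A‖ + η ‖g‖`, which is small.

Conditions 1–3 give the core property by direct estimates with rearrangements. Condition 4 gives it
through `f^*(s) φ(s) ≤ ‖f‖_X`. Conditions 5, 6 and 8 imply 4 through a power bound `φ(t) (s/t)^a ≤ K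
φ(s)` with `a < 1/p`; condition 7 implies 4 by a change of variables, and 9 implies 8 by testing
dilations on indicator functions. -/

noncomputable section

/-! ### Metric measure spaces with finite positive balls -/

section Prelim

variable {P : Type*} [MetricSpace P] [MeasurableSpace P] {μ : Measure P}

theorem BallsFinitePos.sigmaFinite [BorelSpace P] (hball : BallsFinitePos μ) : SigmaFinite μ := by
  rcases isEmpty_or_nonempty P with hP | ⟨⟨x₀⟩⟩
  · rw [Measure.eq_zero_of_isEmpty μ]; infer_instance
  refine ⟨⟨⟨fun n : ℕ => Metric.ball x₀ (n + 1), fun _ => trivial,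
    fun n => (hball x₀ _ (by positivity)).2, ?_⟩⟩⟩
  refine eq_univ_of_forall fun x => mem_iUnion.2 ?_
  obtain ⟨n, hn⟩ := exists_nat_gt (dist x x₀)
  exact ⟨n, by rw [Metric.mem_ball]; linarith⟩

theorem BallsFinitePos.isLocallyFiniteMeasure (hball : BallsFinitePos μ) :
    IsLocallyFiniteMeasure μ :=
  ⟨fun x => ⟨Metric.ball x 1, Metric.ball_mem_nhds x one_pos, (hball x 1 one_pos).2⟩⟩

theorem BallsFinitePos.countable_of_pairwiseDisjoint [BorelSpace P] (hball : BallsFinitePos μ)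
    {u : Set P} {r : P → ℝ} (hr : ∀ x ∈ u, 0 < r x)
    (hu : u.PairwiseDisjoint fun x => Metric.closedBall x (r x)) : u.Countable := by
  have := hball.sigmaFinite
  have h1 : Set.Countable {i : u | 0 < μ (Metric.ball (i : P) (r i))} :=
    Measure.countable_meas_pos_of_disjoint_iUnion (fun _ => Metric.isOpen_ball.measurableSet)
      fun i j hij => (hu i.2 j.2 (fun h => hij (Subtype.ext h))).mono
        Metric.ball_subset_closedBall Metric.ball_subset_closedBall
  have h2 : {i : u | 0 < μ (Metric.ball (i : P) (r i))} = univ :=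
    eq_univ_of_forall fun i => (hball i _ (hr i i.2)).1
  rw [h2] at h1
  exact countable_coe_iff.1 (countable_univ_iff.1 h1)

/-- A disjoint Vitali subfamily of the balls of radius `ε/5` is countable by σ-finiteness, and its
fivefold enlargements cover, so its centres are almost dense. -/
theorem BallsFinitePos.secondCountableTopology [BorelSpace P] (hball : BallsFinitePos μ) :
    SecondCountableTopology P := by
  refine Metric.secondCountable_of_almost_dense_set fun ε hε => ?_
  obtain ⟨u, -, hu, hcov⟩ := Vitali.exists_disjoint_subfamily_covering_enlargement_closedBall
    (univ : Set P) (fun x => x) (fun _ => ε / 5) (ε / 5) (fun _ _ => le_rfl) 5 (by norm_num)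
  refine ⟨u, hball.countable_of_pairwiseDisjoint (r := fun _ => ε / 5)
    (fun _ _ => by positivity) hu, fun x => ?_⟩
  obtain ⟨y, hy, hxy⟩ := hcov x (mem_univ x)
  refine ⟨y, hy, ?_⟩
  have := hxy (Metric.mem_closedBall_self (by positivity))
  rw [Metric.mem_closedBall] at this
  linarith

theorem isUnifLocDoublingMeasure_of_isDoubling (hdoubling : IsDoubling μ) :
    IsUnifLocDoublingMeasure μ := by
  obtain ⟨C, hC⟩ := hdoubling
  refine ⟨C * C, ?_⟩
  filter_upwards [self_mem_nhdsWithin] with r hr x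
  have hr : 0 < r := hr
  calc μ (Metric.closedBall x (2 * r)) ≤ μ (Metric.ball x (2 * (2 * r))) :=
        measure_mono (Metric.closedBall_subset_ball (by linarith))
    _ ≤ C * (C * μ (Metric.ball x r)) :=
        (hC x _ (by positivity)).trans (mul_le_mul_right (hC x r hr) _)
    _ ≤ C * (C * μ (Metric.closedBall x r)) := by
        gcongr; exact Metric.ball_subset_closedBall
    _ = _ := by push_cast; ring

/-! ### Subsets of prescribed measure -/

/-- Intermediate value theorem for the distribution function `a ↦ ν (Iic a)`: it is continuous
because there are no point masses, so it takes the value `s` at the infimum of the points where it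
is at least `s`. -/
theorem exists_measure_Iic_eq (ν : Measure ℝ) [IsFiniteMeasure ν] [NullSingletonClass ν]
    {s : ℝ≥0∞} (hs : 0 < s) (hs' : s < ν univ) : ∃ a, ν (Iic a) = s := by
  set S : Set ℝ := {a | s ≤ ν (Iic a)} with hS
  have hne : S.Nonempty := by
    have := (tendsto_measure_Iic_atTop ν).eventually (lt_mem_nhds hs')
    obtain ⟨a, ha⟩ := this.exists
    exact ⟨a, ha.le⟩
  have hbdd : BddBelow S := by
    have := (tendsto_measure_Ici_atBot ν).eventually (lt_mem_nhds
      (ENNReal.sub_lt_self (measure_ne_top ν _) (hs.trans hs').ne' hs.ne'))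
    obtain ⟨a, ha⟩ := this.exists
    refine ⟨a, fun b hb => le_of_not_gt fun hba => ha.not_ge ?_⟩
    refine ENNReal.le_sub_of_add_le_right hs'.ne_top ?_
    calc ν (Ici a) + s ≤ ν (Ioi b) + ν (Iic b) :=
          add_le_add (measure_mono fun x hx => lt_of_lt_of_le hba hx) hb
      _ = ν univ := by rw [← compl_Iic, add_comm, measure_add_measure_compl measurableSet_Iic]
  refine ⟨sInf S, le_antisymm ?_ ?_⟩
  · obtain ⟨u, hu, hlt, htend⟩ := exists_seq_strictMono_tendsto (sInf S)
    rw [← Iio_ae_eq_Iic.measure_eq, ← iUnion_Iic_eq_Iio_of_lt_of_tendsto hlt htend,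
      Monotone.measure_iUnion fun i j hij => Iic_subset_Iic.2 (hu.monotone hij)]
    refine iSup_le fun n => le_of_lt (lt_of_not_ge fun h => ?_)
    exact (lt_irrefl _) ((hlt n).trans_le (csInf_le hbdd h))
  · obtain ⟨u, hu, hlt, htend⟩ := exists_seq_strictAnti_tendsto (sInf S)
    have h1 : ν (Ioi (sInf S)) + s ≤ ν univ := by
      rw [← iUnion_Ici_eq_Ioi_of_lt_of_tendsto hlt htend,
        Monotone.measure_iUnion fun i j hij => Ici_subset_Ici.2 (hu.antitone hij),
        ENNReal.iSup_add]
      refine iSup_le fun n => ?_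
      obtain ⟨b, hb, hbu⟩ := exists_lt_of_csInf_lt hne (hlt n)
      calc ν (Ici (u n)) + s ≤ ν (Ioi b) + ν (Iic b) :=
            add_le_add (measure_mono fun x hx => lt_of_lt_of_le hbu hx) hb
        _ = ν univ := by rw [← compl_Iic, add_comm, measure_add_measure_compl measurableSet_Iic]
    rw [← measure_add_measure_compl (μ := ν) (measurableSet_Iic (a := sInf S)), compl_Iic,
      add_comm] at h1
    exact (ENNReal.add_le_add_iff_right (measure_ne_top ν _)).1 h1

/-- A measure without point masses on a second countable metric space is non-atomic. -/
theorem exists_subset_measure_eq [BorelSpace P] [SecondCountableTopology P] [SigmaFinite μ]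
    [NullSingletonClass μ] {G : Set P} (hG : NullMeasurableSet G μ) {s : ℝ≥0∞} (hs : s ≤ μ G) :
    ∃ F ⊆ G, NullMeasurableSet F μ ∧ μ F = s := by
  rcases hs.eq_or_lt with rfl | hs
  · exact ⟨G, subset_rfl, hG, rfl⟩
  rcases eq_zero_or_pos s with rfl | hs0
  · exact ⟨∅, empty_subset _, nullMeasurableSet_empty, measure_empty⟩
  obtain ⟨G₀, hG₀, hmeas, heq⟩ := hG.exists_measurable_subset_ae_eq
  obtain ⟨G₁, hG₁m, hG₁, hlt, hfin⟩ :=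
    Measure.exists_subset_measure_lt_top hmeas (by rwa [measure_congr heq])
  -- An injective measurable map to `ℝ` through Cantor space pushes `μ` on the finite piece `G₁` to
  -- a measure without point masses; half-lines pull back to sets of the wanted measure.
  obtain ⟨f, hf, hfinj⟩ := MeasurableSpace.measurable_injection_nat_bool_of_countablySeparated P
  set e : (ℕ → Bool) → ℝ := embeddingReal (ℕ → Bool)
  have he := measurableEmbedding_embeddingReal (ℕ → Bool)
  have hh : Measurable (e ∘ f) := he.measurable.comp hf
  have hinj : Function.Injective (e ∘ f) := he.injective.comp hfinj
  set ν := (μ.restrict G₁).map (e ∘ f)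
  have : IsFiniteMeasure (μ.restrict G₁) := ⟨by simpa using hfin⟩
  have : IsFiniteMeasure ν := Measure.isFiniteMeasure_map _ _
  have : NullSingletonClass ν := ⟨fun x => by
    rw [Measure.map_apply hh (measurableSet_singleton x)]
    exact (subsingleton_singleton.preimage hinj).measure_zero _⟩
  obtain ⟨a, ha⟩ := exists_measure_Iic_eq ν hs0 (by
    rwa [Measure.map_apply hh MeasurableSet.univ, preimage_univ, Measure.restrict_apply_univ])
  rw [Measure.map_apply hh measurableSet_Iic,
    Measure.restrict_apply (hh measurableSet_Iic)] at ha
  exact ⟨_, inter_subset_right.trans (hG₁.trans hG₀),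
    ((hh measurableSet_Iic).inter hG₁m).nullMeasurableSet, ha⟩

/-! ### Weak type estimate for the centered maximal function -/

/-- Vitali covering: the disjoint selected balls carry the integral, and their fivefold enlargements
lie in eightfold balls, which costs three doublings, hence `C ^ 3`. The exceptional set enters only
through its outer measure. -/
theorem mul_measure_le_lintegral_of_maximal [BorelSpace P] (hball : BallsFinitePos μ) {C : ℝ≥0}
    (hC : ∀ (x : P) (r : ℝ), 0 < r → μ (Metric.ball x (2 * r)) ≤ C * μ (Metric.ball x r))
    (H : P → ℝ≥0∞) (a : ℝ≥0∞) :
    a * μ {x | ∃ r > 0, a * μ (Metric.ball x r) < ∫⁻ y in Metric.ball x r, H y ∂μ} ≤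
      C ^ 3 * ∫⁻ y, H y ∂μ := by
  -- The covering lemma needs bounded radii, so the set is exhausted by the restrictions `r ≤ n`.
  set S : ℕ → Set P := fun n =>
    {x | ∃ r : ℝ, r > 0 ∧ r ≤ n ∧ a * μ (Metric.ball x r) < ∫⁻ y in Metric.ball x r, H y ∂μ} with hS
  have hU : {x | ∃ r > 0, a * μ (Metric.ball x r) < ∫⁻ y in Metric.ball x r, H y ∂μ} =
      ⋃ n, S n := by
    ext x
    simp only [hS, mem_ofPred_eq, mem_iUnion]
    constructor
    · rintro ⟨r, hr, h⟩
      obtain ⟨n, hn⟩ := exists_nat_ge r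
      exact ⟨n, r, hr, hn, h⟩
    · rintro ⟨n, r, hr, -, h⟩
      exact ⟨r, hr, h⟩
  have hmono : Monotone S := fun m n hmn x ⟨r, hr, hrm, h⟩ =>
    ⟨r, hr, hrm.trans (by exact_mod_cast hmn), h⟩
  rw [hU, hmono.measure_iUnion, ENNReal.mul_iSup]
  refine iSup_le fun n => ?_
  have hex : ∀ x, ∃ r : ℝ, x ∈ S n → 0 < r ∧ r ≤ n ∧
      a * μ (Metric.ball x r) < ∫⁻ y in Metric.ball x r, H y ∂μ := by
    intro x
    by_cases hx : x ∈ S n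
    · obtain ⟨r, h1, h2, h3⟩ := hx
      exact ⟨r, fun _ => ⟨h1, h2, h3⟩⟩
    · exact ⟨0, fun h => absurd h hx⟩
  choose r hr using hex
  obtain ⟨u, huS, hu, hcov⟩ := Vitali.exists_disjoint_subfamily_covering_enlargement_closedBall
    (S n) (fun x => x) r n (fun x hx => (hr x hx).2.1) 5 (by norm_num)
  have hcount : u.Countable :=
    hball.countable_of_pairwiseDisjoint (fun x hx => (hr x (huS hx)).1) hu
  have hsub : S n ⊆ ⋃ y ∈ u, Metric.closedBall y (5 * r y) := by
    intro x hx
    obtain ⟨y, hy, hxy⟩ := hcov x hx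
    exact mem_biUnion hy (hxy (Metric.mem_closedBall_self (hr x hx).1.le))
  have hone : ∀ y ∈ u, μ (Metric.closedBall y (5 * r y)) ≤ C ^ 3 * μ (Metric.ball y (r y)) := by
    intro y hy
    have hry := (hr y (huS hy)).1
    calc μ (Metric.closedBall y (5 * r y)) ≤ μ (Metric.ball y (2 * (2 * (2 * r y)))) :=
          measure_mono (Metric.closedBall_subset_ball (by linarith))
      _ ≤ C * (C * (C * μ (Metric.ball y (r y)))) := by
          refine (hC y _ (by positivity)).trans ?_
          gcongr
          refine (hC y _ (by positivity)).trans ?_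
          gcongr
          exact hC y _ hry
      _ = _ := by ring
  have := hcount.to_subtype
  calc a * μ (S n) ≤ a * ∑' y : u, μ (Metric.closedBall (y : P) (5 * r y)) := by
        gcongr
        exact (measure_mono hsub).trans (measure_biUnion_le _ hcount _)
    _ ≤ a * ∑' y : u, C ^ 3 * μ (Metric.ball (y : P) (r y)) := by
        gcongr with y
        exact hone y y.2
    _ = C ^ 3 * ∑' y : u, a * μ (Metric.ball (y : P) (r y)) := by
        rw [ENNReal.tsum_mul_left, ENNReal.tsum_mul_left]; ring
    _ ≤ C ^ 3 * ∑' y : u, ∫⁻ z in Metric.ball (y : P) (r y), H z ∂μ := by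
        gcongr with y
        exact (hr y (huS y.2)).2.2.le
    _ = C ^ 3 * ∫⁻ z in ⋃ y : u, Metric.ball (y : P) (r y), H z ∂μ := by
        rw [lintegral_iUnion (fun _ => Metric.isOpen_ball.measurableSet)
          (fun i j hij => (hu i.2 j.2 (fun h => hij (Subtype.ext h))).mono
            Metric.ball_subset_closedBall Metric.ball_subset_closedBall)]
    _ ≤ _ := by gcongr; exact Measure.restrict_le_self

/-! ### Pointwise estimates from oscillation bounds -/

theorem abs_setAverage_sub_le {P : Type*} [MeasurableSpace P] {μ : Measure P} {B B' : Set P}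
    (hB' : B' ⊆ B) (hpos : 0 < μ B') (hfin : μ B < ∞)
    {K : ℝ≥0} (hK : μ B ≤ K * μ B') {u : P → ℝ} (hu : IntegrableOn u B μ) (a : ℝ) :
    |(⨍ y in B', u y ∂μ) - a| ≤ K * ⨍ y in B, |u y - a| ∂μ := by
  have hfin' : μ B' < ∞ := (measure_mono hB').trans_lt hfin
  have hm' : 0 < μ.real B' := ENNReal.toReal_pos hpos.ne' hfin'.ne
  have hm : 0 < μ.real B := ENNReal.toReal_pos (hpos.trans_le (measure_mono hB')).ne' hfin.ne
  have hKr : μ.real B ≤ K * μ.real B' := by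
    have := ENNReal.toReal_mono (ENNReal.mul_ne_top ENNReal.coe_ne_top hfin'.ne) hK
    simpa [Measure.real] using this
  have hi : IntegrableOn (fun y => u y - a) B μ := hu.sub (integrableOn_const hfin.ne)
  have h1 : (⨍ y in B', u y ∂μ) - a = (μ.real B')⁻¹ * ∫ y in B', (u y - a) ∂μ := by
    rw [integral_sub (hu.mono_set hB') (integrableOn_const hfin'.ne), setAverage_eq, smul_eq_mul,
      setIntegral_const, smul_eq_mul]
    field_simp
  rw [h1, abs_mul, abs_of_pos (inv_pos.2 hm'), setAverage_eq, smul_eq_mul, ← mul_assoc]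
  have h2 : |∫ y in B', (u y - a) ∂μ| ≤ ∫ y in B, |u y - a| ∂μ :=
    (abs_integral_le_integral_abs).trans
      (setIntegral_mono_set hi.abs (Eventually.of_forall fun _ => abs_nonneg _)
        (LE.le.eventuallyLE hB'))
  refine mul_le_mul ?_ h2 (abs_nonneg _) (by positivity)
  rw [inv_le_iff_one_le_mul₀ hm', mul_assoc, mul_comm _ (μ.real B'), ← mul_assoc,
    ← div_eq_mul_inv, one_le_div hm]
  exact hKr

variable {C : ℝ≥0}

/-- Lebesgue's differentiation theorem is available for closed balls; passing to open balls of the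
same radius costs a factor `C`, since `closedBall x r ⊆ ball x (2 * r)`. -/
theorem ae_tendsto_setAverage_ball [BorelSpace P] (hball : BallsFinitePos μ)
    (hC : ∀ (x : P) (r : ℝ), 0 < r → μ (Metric.ball x (2 * r)) ≤ C * μ (Metric.ball x r))
    {u : P → ℝ} (hu : ∀ (y : P) (R : ℝ), IntegrableOn u (Metric.ball y R) μ) :
    ∀ᵐ x ∂μ, Tendsto (fun r : ℝ => ⨍ y in Metric.ball x r, u y ∂μ) (𝓝[>] 0) (𝓝 (u x)) := by
  have := hball.secondCountableTopology
  have := hball.isLocallyFiniteMeasure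
  have := isUnifLocDoublingMeasure_of_isDoubling ⟨C, hC⟩
  have hloc : LocallyIntegrable u μ := fun x =>
    ⟨Metric.ball x 1, Metric.ball_mem_nhds x one_pos, hu x 1⟩
  filter_upwards [IsUnifLocDoublingMeasure.ae_tendsto_average_norm_sub μ hloc 1] with x hx
  have h0 := hx (l := 𝓝[>] (0 : ℝ)) (fun _ => x) (fun r => r) tendsto_id (by
    filter_upwards [self_mem_nhdsWithin] with r hr
    exact Metric.mem_closedBall_self (by simpa using (mem_Ioi.1 hr).le))
  rw [tendsto_iff_dist_tendsto_zero]
  have h1 := h0.const_mul (C : ℝ)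
  rw [mul_zero] at h1
  refine squeeze_zero' (Eventually.of_forall fun _ => dist_nonneg) ?_ h1
  filter_upwards [self_mem_nhdsWithin] with r hr
  have hr : 0 < r := hr
  have hsub : Metric.closedBall x r ⊆ Metric.ball x (2 * r) :=
    Metric.closedBall_subset_ball (by linarith)
  exact abs_setAverage_sub_le Metric.ball_subset_closedBall (hball x r hr).1
    ((measure_mono hsub).trans_lt (hball x _ (by positivity)).2)
    ((measure_mono hsub).trans (hC x r hr)) ((hu x (2 * r)).mono_set hsub) _

/-- Telescoping over the radii `r / 2 ^ n`: consecutive means differ by at most `C * A * r / 2 ^ n`,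
and the geometric series sums to twice its first term. -/
theorem abs_setAverage_ball_sub_le_of_oscillation (hball : BallsFinitePos μ)
    (hC : ∀ (x : P) (r : ℝ), 0 < r → μ (Metric.ball x (2 * r)) ≤ C * μ (Metric.ball x r))
    {u : P → ℝ} (hu : ∀ (y : P) (R : ℝ), IntegrableOn u (Metric.ball y R) μ) {A : ℝ} {x : P}
    (hx : Tendsto (fun r : ℝ => ⨍ y in Metric.ball x r, u y ∂μ) (𝓝[>] 0) (𝓝 (u x)))
    (hosc : ∀ r > 0, ⨍ y in Metric.ball x r, |u y - ⨍ z in Metric.ball x r, u z ∂μ| ∂μ ≤ A * r)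
    {r : ℝ} (hr : 0 < r) : |(⨍ y in Metric.ball x r, u y ∂μ) - u x| ≤ 2 * C * A * r := by
  set a : ℕ → ℝ := fun n => ⨍ y in Metric.ball x (r / 2 ^ n), u y ∂μ with ha
  have htend : Tendsto a atTop (𝓝 (u x)) := by
    refine hx.comp (tendsto_nhdsWithin_iff.2 ⟨?_, Eventually.of_forall fun n =>
      div_pos hr (by positivity)⟩)
    have := (tendsto_pow_atTop_nhds_zero_of_lt_one (r := (1 / 2 : ℝ)) (by norm_num)
      (by norm_num)).const_mul r
    simpa [div_eq_mul_inv] using this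
  have hstep : ∀ n, dist (a n) (a (n + 1)) ≤ 2 * C * A * r / 2 / 2 ^ n := by
    intro n
    have hrn : 0 < r / 2 ^ (n + 1) := by positivity
    have h2 : 2 * (r / 2 ^ (n + 1)) = r / 2 ^ n := by rw [pow_succ]; field_simp
    have h3 := hC x _ hrn
    rw [h2] at h3
    have hrn' : 0 < r / 2 ^ n := by positivity
    rw [dist_comm, Real.dist_eq]
    refine (abs_setAverage_sub_le (K := C) (B := Metric.ball x (r / 2 ^ n))
      (Metric.ball_subset_ball (by linarith)) (hball x _ hrn).1 (hball x _ hrn').2 h3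
      (hu x _) _).trans ?_
    calc (C : ℝ) * _ ≤ C * (A * (r / 2 ^ n)) :=
          mul_le_mul_of_nonneg_left (hosc _ hrn') C.2
      _ = _ := by field_simp
  have := dist_le_of_le_geometric_two_of_tendsto₀ hstep htend
  simpa [ha, Real.dist_eq] using this

/-- With `d = dist x y`, go from `u x` to the mean over `B(x, 2d)`, to the mean over `B(y, d)`, to
`u y`. The three costs are `4 C A d`, `2 C ^ 2 A d` (two doublings compare the balls) and `2 C A d`.
-/
theorem abs_sub_le_of_oscillation (hball : BallsFinitePos μ)
    (hC : ∀ (x : P) (r : ℝ), 0 < r → μ (Metric.ball x (2 * r)) ≤ C * μ (Metric.ball x r))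
    {u : P → ℝ} (hu : ∀ (y : P) (R : ℝ), IntegrableOn u (Metric.ball y R) μ) {A : ℝ} {x y : P}
    (hx : Tendsto (fun r : ℝ => ⨍ y in Metric.ball x r, u y ∂μ) (𝓝[>] 0) (𝓝 (u x)))
    (hy : Tendsto (fun r : ℝ => ⨍ z in Metric.ball y r, u z ∂μ) (𝓝[>] 0) (𝓝 (u y)))
    (hxosc : ∀ r > 0, ⨍ y in Metric.ball x r, |u y - ⨍ z in Metric.ball x r, u z ∂μ| ∂μ ≤ A * r)
    (hyosc : ∀ r > 0, ⨍ w in Metric.ball y r, |u w - ⨍ z in Metric.ball y r, u z ∂μ| ∂μ ≤ A * r) :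
    |u x - u y| ≤ (6 * C + 2 * C ^ 2) * A * dist x y := by
  rcases eq_or_ne x y with rfl | hne
  · simp
  have hd : 0 < dist x y := dist_pos.2 hne
  have h1 := abs_setAverage_ball_sub_le_of_oscillation hball hC hu hx hxosc
    (r := 2 * dist x y) (by positivity)
  have h2 := abs_setAverage_ball_sub_le_of_oscillation hball hC hu hy hyosc hd
  have hsub : Metric.ball y (dist x y) ⊆ Metric.ball x (2 * dist x y) :=
    Metric.ball_subset_ball' (by rw [dist_comm y x]; linarith)
  have hsub' : Metric.ball x (2 * dist x y) ⊆ Metric.ball y (2 * (2 * dist x y)) :=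
    Metric.ball_subset_ball' (by linarith)
  have hm : μ (Metric.ball x (2 * dist x y)) ≤ (C ^ 2 : ℝ≥0) * μ (Metric.ball y (dist x y)) := by
    calc _ ≤ _ := measure_mono hsub'
      _ ≤ C * (C * μ (Metric.ball y (dist x y))) := by
          refine (hC y _ (by positivity)).trans ?_
          gcongr
          exact hC y _ hd
      _ = _ := by push_cast; ring
  have h3 := abs_setAverage_sub_le hsub (hball y _ hd).1 (hball x _ (by positivity)).2 hm
    (hu x _) (⨍ z in Metric.ball x (2 * dist x y), u z ∂μ)
  have h4 := mul_le_mul_of_nonneg_left (hxosc (2 * dist x y) (by positivity))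
    (show (0 : ℝ) ≤ C ^ 2 by positivity)
  push_cast at h3
  rw [abs_le] at *
  constructor <;> linarith [h1.1, h1.2, h2.1, h2.2, h3.1, h3.2]

end Prelim

/-! ### Extended real absolute values -/

theorem EReal.measurable_abs : Measurable EReal.abs := by
  refine EReal.measurable_of_measurable_real ?_
  simp only [EReal.abs_def]
  fun_prop

theorem EReal.abs_coe_sub_coe (a b : ℝ) :
    ((a : EReal) - (b : EReal)).abs = ENNReal.ofReal |a - b| := by
  rw [← EReal.coe_sub, EReal.abs_def]

/-- Since `∞ - ∞` has infinite absolute value in `EReal`, finite differences occur only between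
reals. Inequalities bounded by `(a - b).abs` thereby reduce to real ones. -/
theorem EReal.exists_real_of_abs_sub_lt_top {a b : EReal} (h : (a - b).abs < ∞) :
    ∃ x y : ℝ, a = x ∧ b = y := by
  induction a <;> induction b <;> simp_all

theorem EReal.abs_add_coe_sub_le (a b : EReal) (x y : ℝ) :
    ((a + x) - (b + y)).abs ≤ (a - b).abs + ((x : EReal) - y).abs := by
  by_cases h : (a - b).abs < ∞
  · obtain ⟨c, d, rfl, rfl⟩ := EReal.exists_real_of_abs_sub_lt_top h
    rw [← EReal.coe_add, ← EReal.coe_add, EReal.abs_coe_sub_coe, EReal.abs_coe_sub_coe,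
      EReal.abs_coe_sub_coe, ← ENNReal.ofReal_add (abs_nonneg _) (abs_nonneg _)]
    refine ENNReal.ofReal_le_ofReal ?_
    calc |c + x - (d + y)| = |(c - d) + (x - y)| := by ring_nf
      _ ≤ _ := abs_add_le _ _
  · rw [not_lt_top_iff.1 h, top_add]; exact le_top

theorem EReal.abs_add_coe_le (a : EReal) (x : ℝ) :
    (a + x).abs ≤ a.abs + (x : EReal).abs := by
  have := EReal.abs_add_coe_sub_le a 0 x 0
  simpa using this

/-! ### Upper gradients -/

section UpperGradient

variable {P : Type*} [PseudoMetricSpace P] [MeasurableSpace P]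

theorem HasUnitSpeedOn.comp_add_right {P : Type*} [PseudoMetricSpace P] {γ : ℝ → P}
    {l a b : ℝ} (hγ : HasUnitSpeedOn γ (Icc 0 l))
    (ha : 0 ≤ a) (hb : b ≤ l) : HasUnitSpeedOn (fun t => γ (t + a)) (Icc 0 (b - a)) := by
  intro x hx y hy
  have himage : (fun t => t + a) '' (Icc 0 (b - a) ∩ Icc x y) = Icc 0 l ∩ Icc (x + a) (y + a) := by
    ext t
    simp only [mem_image, mem_inter_iff, mem_Icc] at *
    constructor
    · rintro ⟨s, hs, rfl⟩
      refine ⟨⟨?_, ?_⟩, ?_, ?_⟩ <;> linarith [hs.1.1, hs.1.2, hs.2.1, hs.2.2]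
    · rintro ⟨h1, h2⟩
      refine ⟨t - a, ⟨⟨?_, ?_⟩, ?_, ?_⟩, by ring⟩ <;> linarith [hx.1, hy.2]
  have hcomp := eVariationOn.comp_eq_of_monotoneOn γ (t := Icc 0 (b - a) ∩ Icc x y)
    (fun t : ℝ => t + a) (fun s _ t _ h => by simpa using h)
  rw [himage] at hcomp
  have := hγ (x := x + a) ⟨by linarith [hx.1], by linarith [hx.2]⟩ (y := y + a)
    ⟨by linarith [hy.1], by linarith [hy.2]⟩
  rw [add_sub_add_right_eq_sub] at this
  rw [← this, ← hcomp]
  rfl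

theorem IsUpperGradient.abs_sub_le_subcurve {u : P → EReal} {g : P → ℝ≥0∞}
    (h : IsUpperGradient u g) {γ : ℝ → P} {l a b : ℝ} (hγ : HasUnitSpeedOn γ (Icc 0 l))
    (ha : 0 ≤ a) (hab : a < b) (hb : b ≤ l) :
    (u (γ a) - u (γ b)).abs ≤ ∫⁻ t in Icc a b, g (γ t) := by
  have := h.2 (fun t => γ (t + a)) (b - a) (by linarith) (hγ.comp_add_right ha hb)
  simp only [zero_add, sub_add_cancel] at this
  have hpre : Icc 0 (b - a) = (fun t => t + a) ⁻¹' (Icc a b) := by simp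
  rwa [hpre, (measurePreserving_add_right volume a).setLIntegral_comp_preimage_emb
    (measurableEmbedding_addRight a) (fun t => g (γ t))] at this

theorem IsUpperGradient.of_abs_sub_le {u v : P → EReal} {g : P → ℝ≥0∞} (h : IsUpperGradient u g)
    (huv : ∀ x y, (v x - v y).abs ≤ (u x - u y).abs) : IsUpperGradient v g :=
  ⟨h.1, fun γ l hl hγ => (huv _ _).trans (h.2 γ l hl hγ)⟩

theorem IsUpperGradient.of_abs_sub_le_add {u v w : P → EReal} {g h : P → ℝ≥0∞}
    (hu : IsUpperGradient u g) (hv : IsUpperGradient v h)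
    (hw : ∀ x y, (w x - w y).abs ≤ (u x - u y).abs + (v x - v y).abs) :
    IsUpperGradient w (fun x => g x + h x) :=
  ⟨hu.1.add hv.1, fun γ l hl hγ => (hw _ _).trans
    ((add_le_add (hu.2 γ l hl hγ) (hv.2 γ l hl hγ)).trans (le_lintegral_add _ _))⟩

theorem LipschitzWith.isUpperGradient_const {v : P → ℝ} {K : ℝ≥0} (hv : LipschitzWith K v) :
    IsUpperGradient (fun x => (v x : EReal)) (fun _ => K) := by
  refine ⟨measurable_const, fun γ l hl hγ => ?_⟩
  have h0 : (0 : ℝ) ∈ Icc 0 l := ⟨le_rfl, hl.le⟩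
  have h1 : l ∈ Icc 0 l := ⟨hl.le, le_rfl⟩
  have h2 : edist (γ 0) (γ l) ≤ ENNReal.ofReal l := by
    have := hγ h0 h1
    rw [inter_self] at this
    refine (eVariationOn.edist_le γ h0 h1).trans (this.le.trans_eq ?_)
    simp
  rw [EReal.abs_coe_sub_coe, ← Real.dist_eq, ← edist_dist, lintegral_const]
  simp only [MeasurableSet.univ, Measure.restrict_apply, univ_inter, Real.volume_Icc, sub_zero]
  exact (hv _ _).trans (by gcongr)

/-- An upper gradient may be cut off outside a set off which the function vanishes, up to adding a
function which controls it along curves. -/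
theorem IsUpperGradient.indicator_add {w : P → EReal} {h k : P → ℝ≥0∞}
    (hw : IsUpperGradient w h) (hk : Measurable k) {c : ℝ≥0} (hle : ∀ x, h x ≤ c * (k x + 1))
    {A : Set P} (hA : MeasurableSet A) (hwA : ∀ x ∉ A, w x = 0) :
    IsUpperGradient w (fun x => A.indicator h x + k x) := by
  refine ⟨(hw.1.indicator hA).add hk, fun γ l hl hγ => ?_⟩
  -- This is the role of `k`: curves along which it is not integrable satisfy the inequality
  -- trivially, and along the others `hle` makes `h` integrable, which forces `w ∘ γ` to be
  -- continuous.
  by_cases hfin : ∫⁻ t in Icc 0 l, (A.indicator h (γ t) + k (γ t)) = ∞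
  · rw [hfin]; exact le_top
  have hkfin : ∫⁻ t in Icc 0 l, k (γ t) ≠ ∞ :=
    ne_top_of_le_ne_top hfin (lintegral_mono fun t => le_add_self)
  have hhfin : ∫⁻ t in Icc 0 l, h (γ t) ≠ ∞ := by
    refine ne_top_of_le_ne_top ?_ (lintegral_mono fun t => hle (γ t))
    rw [lintegral_const_mul' _ _ ENNReal.coe_ne_top, lintegral_add_right _ measurable_const]
    refine ENNReal.mul_ne_top ENNReal.coe_ne_top (ENNReal.add_ne_top.2 ⟨hkfin, ?_⟩)
    simp
  have hsub : ∀ a b, 0 ≤ a → a < b → b ≤ l →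
      (w (γ a) - w (γ b)).abs ≤ ∫⁻ t in Icc a b, h (γ t) ∂(volume.restrict (Icc 0 l)) := by
    intro a b ha hab hb
    rw [Measure.restrict_restrict measurableSet_Icc,
      inter_eq_self_of_subset_left (Icc_subset_Icc ha hb)]
    exact hw.abs_sub_le_subcurve hγ ha hab hb
  have hfinsub : ∀ a b, 0 ≤ a → a < b → b ≤ l → (w (γ a) - w (γ b)).abs < ∞ := fun a b ha hab hb =>
    (hsub a b ha hab hb).trans_lt ((setLIntegral_le_lintegral _ _).trans_lt hhfin.lt_top)
  have hreal : ∀ t ∈ Icc 0 l, ∃ x : ℝ, w (γ t) = x := by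
    intro t ht
    rcases ht.2.lt_or_eq with h' | rfl
    · obtain ⟨x, y, hx, -⟩ := EReal.exists_real_of_abs_sub_lt_top (hfinsub t l ht.1 h' le_rfl)
      exact ⟨x, hx⟩
    · obtain ⟨x, y, -, hy⟩ := EReal.exists_real_of_abs_sub_lt_top (hfinsub 0 t le_rfl hl le_rfl)
      exact ⟨y, hy⟩
  set W : ℝ → ℝ := fun t => (w (γ t)).toReal with hWdef
  have hW : ∀ t ∈ Icc 0 l, w (γ t) = W t := by
    intro t ht
    obtain ⟨x, hx⟩ := hreal t ht
    simp [hWdef, hx]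
  have hWsub : ∀ a ∈ Icc 0 l, ∀ b ∈ Icc 0 l, a ≤ b →
      ENNReal.ofReal |W a - W b| ≤ ∫⁻ t in Icc a b, h (γ t) ∂(volume.restrict (Icc 0 l)) := by
    intro a ha b hb hab
    rcases hab.eq_or_lt with rfl | hab
    · simp
    have := hsub a b ha.1 hab hb.2
    rwa [hW a ha, hW b hb, EReal.abs_coe_sub_coe] at this
  -- Absolute continuity of the integral of `h ∘ γ`.
  have hcont : ContinuousOn W (Icc 0 l) := by
    rw [Metric.continuousOn_iff]
    intro b hb ε hε
    obtain ⟨δ, hδ, hδ'⟩ := exists_pos_setLIntegral_lt_of_measure_lt hhfin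
      (ENNReal.ofReal_pos.2 hε).ne'
    -- `δ` may be infinite; the minimum with `1` makes it a real number.
    have hmin : min δ 1 ≠ ∞ := ne_top_of_le_ne_top ENNReal.one_ne_top (min_le_right _ _)
    refine ⟨(min δ 1).toReal, ENNReal.toReal_pos (by positivity) hmin, fun a ha hab => ?_⟩
    have key : ∀ s t, s ∈ Icc 0 l → t ∈ Icc 0 l → s ≤ t → t - s < (min δ 1).toReal →
        |W s - W t| < ε := by
      intro s t hs ht hst hlt
      rw [← ENNReal.ofReal_lt_ofReal_iff hε]
      refine (hWsub s hs t ht hst).trans_lt (hδ' _ ?_)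
      refine (Measure.restrict_apply_le _ _).trans_lt ?_
      rw [Real.volume_Icc]
      exact ((ENNReal.ofReal_lt_iff_lt_toReal (by linarith) hmin).2 hlt).trans_le (min_le_left _ _)
    rw [Real.dist_eq] at hab ⊢
    rcases le_total a b with hle | hle
    · exact key a b ha hb hle (by rw [abs_sub_comm] at hab; exact (le_abs_self _).trans_lt hab)
    · rw [abs_sub_comm]
      exact key b a hb ha hle ((le_abs_self _).trans_lt hab)
  have h0 : (0 : ℝ) ∈ Icc 0 l := ⟨le_rfl, hl.le⟩
  have h1 : l ∈ Icc 0 l := ⟨hl.le, le_rfl⟩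
  have hind : ∀ t ∈ Icc 0 l, W t ≠ 0 → h (γ t) ≤ A.indicator h (γ t) := by
    intro t ht hne
    rw [indicator_of_mem]
    by_contra hnot
    exact hne (by simp [hWdef, hwA _ hnot])
  rw [hW 0 h0, hW l h1, EReal.abs_coe_sub_coe]
  suffices hmain : ENNReal.ofReal |W 0 - W l| ≤ ∫⁻ t in Icc 0 l, A.indicator h (γ t) from
    hmain.trans (lintegral_mono fun t => le_self_add)
  -- Without zeros the whole curve runs in `A`. Otherwise let `a` and `b` be the first and last
  -- zeros: the curve runs in `A` on `[0, a)` and on `(b, l]`, and the part between them contributes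
  -- nothing to `W 0 - W l`.
  set Z : Set ℝ := Icc 0 l ∩ W ⁻¹' {0} with hZ
  have hZc : IsCompact Z :=
    isCompact_Icc.of_isClosed_subset
      (hcont.preimage_isClosed_of_isClosed isClosed_Icc isClosed_singleton) inter_subset_left
  rcases Z.eq_empty_or_nonempty with hemp | hne
  · refine (hWsub 0 h0 l h1 hl.le).trans ?_
    rw [Measure.restrict_restrict measurableSet_Icc, inter_self]
    refine setLIntegral_mono' measurableSet_Icc fun t ht => hind t ht fun h0 => ?_
    exact (hemp ▸ (show t ∈ Z from ⟨ht, h0⟩) : t ∈ (∅ : Set ℝ))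
  · obtain ⟨a, haZ, ha⟩ := hZc.exists_isLeast hne
    obtain ⟨b, hbZ, hb⟩ := hZc.exists_isGreatest hne
    have hab : a ≤ b := ha hbZ
    have hWa : W a = 0 := haZ.2
    have hWb : W b = 0 := hbZ.2
    have e1 : ENNReal.ofReal |W 0| ≤ ∫⁻ t in Ico 0 a, A.indicator h (γ t) := by
      have := hWsub 0 h0 a haZ.1 haZ.1.1
      rw [hWa, sub_zero, Measure.restrict_restrict measurableSet_Icc,
        inter_eq_self_of_subset_left (Icc_subset_Icc le_rfl haZ.1.2),
        ← setLIntegral_congr Ico_ae_eq_Icc] at this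
      refine this.trans (setLIntegral_mono' measurableSet_Ico fun t ht => ?_)
      have htl : t ∈ Icc 0 l := ⟨ht.1, ht.2.le.trans haZ.1.2⟩
      exact hind t htl fun h0 => ht.2.not_ge (ha ⟨htl, h0⟩)
    have e2 : ENNReal.ofReal |W l| ≤ ∫⁻ t in Ioc b l, A.indicator h (γ t) := by
      have := hWsub b hbZ.1 l h1 hbZ.1.2
      rw [hWb, zero_sub, abs_neg, Measure.restrict_restrict measurableSet_Icc,
        inter_eq_self_of_subset_left (Icc_subset_Icc hbZ.1.1 le_rfl),
        ← setLIntegral_congr Ioc_ae_eq_Icc] at this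
      refine this.trans (setLIntegral_mono' measurableSet_Ioc fun t ht => ?_)
      have htl : t ∈ Icc 0 l := ⟨hbZ.1.1.trans ht.1.le, ht.2⟩
      exact hind t htl fun h0 => ht.1.not_ge (hb ⟨htl, h0⟩)
    calc ENNReal.ofReal |W 0 - W l| ≤ ENNReal.ofReal |W 0| + ENNReal.ofReal |W l| := by
          rw [← ENNReal.ofReal_add (abs_nonneg _) (abs_nonneg _)]
          exact ENNReal.ofReal_le_ofReal (abs_sub _ _)
      _ ≤ _ := add_le_add e1 e2
      _ = ∫⁻ t in Ico 0 a ∪ Ioc b l, A.indicator h (γ t) := by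
          rw [lintegral_union measurableSet_Ioc]
          rw [Set.disjoint_left]
          exact fun t ht ht' => ((ht.2.trans_le hab).trans ht'.1).false
      _ ≤ _ := lintegral_mono_set (union_subset
          (Ico_subset_Icc_self.trans (Icc_subset_Icc le_rfl haZ.1.2))
          (Ioc_subset_Icc_self.trans (Icc_subset_Icc hbZ.1.1 le_rfl)))

end UpperGradient

/-! ### Basic properties of rearrangement-invariant spaces -/

namespace RISpace

variable {α : Type*} [MeasurableSpace α] {μ : Measure α} (X : RISpace μ)

theorem indicator_one_eq_zero {E : Set α} (hE : μ E = 0) : X (E.indicator 1) = 0 :=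
  (X.eq_zero_iff _ (aemeasurable_one.indicator₀ (NullMeasurableSet.of_null hE))).2
    (indicator_meas_zero hE)

theorem indicator_one_pos {E : Set α} (hEm : NullMeasurableSet E μ) (hE : μ E ≠ 0) :
    0 < X (E.indicator 1) := by
  rw [pos_iff_ne_zero]
  intro h
  refine hE ?_
  have := (X.eq_zero_iff _ (aemeasurable_one.indicator₀ hEm)).1 h
  rw [indicator_ae_eq_zero] at this
  have hsupp : (Function.support fun _ : α => (1 : ℝ≥0∞)) = univ := by ext; simp
  rwa [hsupp, inter_univ] at this

theorem coe_mul_indicator_one_le {E : Set α} (hE : NullMeasurableSet E μ) {c : ℝ≥0}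
    {f : α → ℝ≥0∞} (hf : AEMeasurable f μ) (h : ∀ x ∈ E, c ≤ f x) :
    c * X (E.indicator 1) ≤ X f := by
  have hm : AEMeasurable (E.indicator (1 : α → ℝ≥0∞)) μ := aemeasurable_one.indicator₀ hE
  rw [← X.smul c _ hm]
  refine X.mono _ _ (hm.const_mul _) hf (Eventually.of_forall fun x => ?_)
  by_cases hx : x ∈ E <;> simp [hx, h]

theorem le_coe_mul_indicator_one {E : Set α} (hE : NullMeasurableSet E μ) {c : ℝ≥0}
    {f : α → ℝ≥0∞} (hf : AEMeasurable f μ) (h : ∀ x ∈ E, f x ≤ c) (h0 : ∀ x ∉ E, f x = 0) :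
    X f ≤ c * X (E.indicator 1) := by
  have hm : AEMeasurable (E.indicator (1 : α → ℝ≥0∞)) μ := aemeasurable_one.indicator₀ hE
  rw [← X.smul c _ hm]
  refine X.mono _ _ hf (hm.const_mul _) (Eventually.of_forall fun x => ?_)
  by_cases hx : x ∈ E <;> simp [hx, h, h0]

theorem indicator_one_congr {E F : Set α} (hE : NullMeasurableSet E μ)
    (hF : NullMeasurableSet F μ) (h : μ E = μ F) : X (E.indicator 1) = X (F.indicator 1) := by
  refine X.rearrangement_invariant _ _ (aemeasurable_one.indicator₀ hE)
    (aemeasurable_one.indicator₀ hF) fun t => ?_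
  have key : ∀ G : Set α, {x | (t : ℝ≥0∞) < G.indicator 1 x} = if t < 1 then G else ∅ := by
    intro G
    ext x
    by_cases hx : x ∈ G <;> by_cases ht : t < 1 <;> simp [hx, ht]
  rw [key, key]
  split_ifs <;> simp [h]

theorem ae_lt_top {f : α → ℝ≥0∞} (hf : AEMeasurable f μ) (hX : X f < ∞) : ∀ᵐ x ∂μ, f x < ∞ := by
  have hE : NullMeasurableSet {x | f x = ∞} μ := hf.nullMeasurable (measurableSet_singleton _)
  have h : ∀ n : ℕ, (n : ℝ≥0∞) * X ({x | f x = ∞}.indicator 1) ≤ X f := fun n => by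
    have := X.coe_mul_indicator_one_le hE (c := n) hf fun x (hx : f x = ∞) => by simp [hx]
    simpa using this
  have h0 : μ {x | f x = ∞} = 0 := by
    by_contra hne
    have hpos := X.indicator_one_pos hE hne
    obtain ⟨n, hn⟩ := ENNReal.exists_nat_mul_gt hpos.ne' hX.ne
    exact (h n).not_gt hn
  rw [ae_iff]
  simpa using h0

/-! ### Consequences of absolute continuity of the norm -/

variable {X}

/-- If the superlevel set `F` had infinite measure, removing sets of finite measure that exhaust the
space would leave sets equimeasurable with `F`. Their indicators would have constant positive norm,
finite by a Chebyshev bound, although the remainders decrease to `∅`. -/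
theorem HasACNorm.measure_superlevel_lt_top [SigmaFinite μ] (hAC : X.HasACNorm) {f : α → ℝ≥0∞}
    (hf : AEMeasurable f μ) (hX : X f < ∞) {c : ℝ≥0} (hc : 0 < c) :
    μ {x | (c : ℝ≥0∞) < f x} < ∞ := by
  set F := {x | (c : ℝ≥0∞) < f x} with hF
  have hFm : NullMeasurableSet F μ := hf.nullMeasurable measurableSet_Ioi
  by_contra hnot
  have htop : μ F = ∞ := not_lt_top_iff.1 hnot
  have hone : AEMeasurable (F.indicator (1 : α → ℝ≥0∞)) μ := aemeasurable_one.indicator₀ hFm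
  have hfin : X (F.indicator 1) < ∞ := by
    have h1 := X.coe_mul_indicator_one_le hFm hf fun x (hx : (c : ℝ≥0∞) < f x) => hx.le
    by_contra h2
    rw [not_lt_top_iff.1 h2, ENNReal.mul_top (by simpa using hc.ne')] at h1
    exact (h1.trans_lt hX).false
  have hEm : ∀ n, NullMeasurableSet ((spanningSets μ n)ᶜ) μ := fun n =>
    (measurableSet_spanningSets μ n).compl.nullMeasurableSet
  have hlim := hAC _ hone hfin (fun n => (spanningSets μ n)ᶜ) hEm
    (fun m n h => compl_subset_compl.2 (monotone_spanningSets μ h)) (by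
      rw [← compl_iUnion, iUnion_spanningSets, compl_univ, measure_empty])
  have hconst : ∀ n, X ((spanningSets μ n)ᶜ.indicator (F.indicator 1)) = X (F.indicator 1) := by
    intro n
    rw [indicator_indicator]
    refine X.indicator_one_congr ((hEm n).inter hFm) hFm ?_
    rw [htop]
    by_contra hne
    have := measure_inter_add_sdiff₀ F (measurableSet_spanningSets μ n).nullMeasurableSet (μ := μ)
    rw [htop] at this
    refine (ENNReal.add_lt_top.2 ⟨?_, ?_⟩).ne this
    · exact (measure_mono inter_subset_right).trans_lt (measure_spanningSets_lt_top μ n)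
    · rw [sdiff_eq, inter_comm]
      exact lt_top_iff_ne_top.2 hne
  simp only [hconst] at hlim
  have := tendsto_nhds_unique hlim tendsto_const_nhds
  exact (X.indicator_one_pos hFm (by simp [htop])).ne this

/-- Borel–Cantelli: counterexamples `A n` with `μ (A n) < 2⁻¹ ^ n` have tails `⋃ m, A (n + m)`
decreasing to a null set, which contradicts absolute continuity. -/
theorem HasACNorm.exists_indicator_lt (hAC : X.HasACNorm) {f : α → ℝ≥0∞}
    (hf : AEMeasurable f μ) (hX : X f < ∞) {ε : ℝ≥0∞} (hε : 0 < ε) :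
    ∃ δ > 0, ∀ A, NullMeasurableSet A μ → μ A < δ → X (A.indicator f) < ε := by
  by_contra! hcon
  have hpos : ∀ n : ℕ, (0 : ℝ≥0∞) < 2⁻¹ ^ n := fun n =>
    ENNReal.pow_pos (by simp) n
  choose A hAm hA hAX using fun n : ℕ => hcon (2⁻¹ ^ n) (hpos n)
  set E : ℕ → Set α := fun n => ⋃ m, A (n + m) with hE
  have hEm : ∀ n, NullMeasurableSet (E n) μ := fun n => NullMeasurableSet.iUnion fun m => hAm _
  have hanti : Antitone E := by
    refine antitone_nat_of_succ_le fun n => iUnion_subset fun m => ?_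
    have : n + 1 + m = n + (m + 1) := by ring
    rw [this]
    exact subset_iUnion (fun m => A (n + m)) (m + 1)
  have hle : ∀ n, μ (E n) ≤ 2⁻¹ ^ n * 2 := by
    intro n
    calc μ (E n) ≤ ∑' m, μ (A (n + m)) := measure_iUnion_le _
      _ ≤ ∑' m, 2⁻¹ ^ n * 2⁻¹ ^ m :=
          ENNReal.tsum_le_tsum fun m => (hA _).le.trans_eq (pow_add _ _ _)
      _ = 2⁻¹ ^ n * 2 := by
          rw [ENNReal.tsum_mul_left, ENNReal.tsum_geometric, ENNReal.one_sub_inv_two, inv_inv]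
  have hzero : μ (⋂ n, E n) = 0 := by
    have hlim : Tendsto (fun n : ℕ => (2⁻¹ : ℝ≥0∞) ^ n * 2) atTop (𝓝 0) := by
      have := ENNReal.Tendsto.mul_const (b := 2)
        (ENNReal.tendsto_pow_atTop_nhds_zero_of_lt_one (r := 2⁻¹) (by simp)) (Or.inr (by simp))
      simpa using this
    exact le_antisymm (ge_of_tendsto' hlim fun n =>
      (measure_mono (iInter_subset _ n)).trans (hle n)) zero_le
  have hlim := hAC f hf hX E hEm hanti hzero
  obtain ⟨n, hn⟩ := (hlim.eventually (gt_mem_nhds hε)).exists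
  refine (hAX n).not_gt (lt_of_le_of_lt ?_ hn)
  refine X.mono _ _ (hf.indicator₀ (hAm n)) (hf.indicator₀ (hEm n)) (Eventually.of_forall ?_)
  refine indicator_le_indicator_of_subset ?_ (fun _ => zero_le)
  simpa using subset_iUnion (fun m => A (n + m)) 0

theorem measure_iInter_superlevel {f : α → ℝ≥0∞} (hf : AEMeasurable f μ) (hX : X f < ∞) :
    μ (⋂ n : ℕ, {x | (n : ℝ≥0∞) < f x}) = 0 := by
  refine measure_mono_null ?_ (ae_iff.1 (X.ae_lt_top hf hX))
  intro x hx
  simp only [mem_iInter, mem_ofPred_eq] at hx ⊢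
  intro hlt
  obtain ⟨n, hn⟩ := ENNReal.exists_nat_gt hlt.ne
  exact (hx n).not_gt hn

theorem antitone_superlevel {α : Type*} (f : α → ℝ≥0∞) :
    Antitone fun n : ℕ => {x | (n : ℝ≥0∞) < f x} :=
  fun m n hmn x (hx : (n : ℝ≥0∞) < f x) =>
    lt_of_le_of_lt (by exact_mod_cast hmn : (m : ℝ≥0∞) ≤ n) hx

theorem HasACNorm.tendsto_indicator_superlevel (hAC : X.HasACNorm) {f : α → ℝ≥0∞}
    (hf : AEMeasurable f μ) (hX : X f < ∞) :
    Tendsto (fun n : ℕ => X ({x | (n : ℝ≥0∞) < f x}.indicator f)) atTop (𝓝 0) :=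
  hAC f hf hX _ (fun _ => hf.nullMeasurable measurableSet_Ioi) (antitone_superlevel f)
    (measure_iInter_superlevel hf hX)

theorem HasACNorm.tendsto_measure_superlevel [SigmaFinite μ] (hAC : X.HasACNorm)
    {f : α → ℝ≥0∞} (hf : AEMeasurable f μ) (hX : X f < ∞) :
    Tendsto (fun n : ℕ => μ {x | (n : ℝ≥0∞) < f x}) atTop (𝓝 0) := by
  have := tendsto_measure_iInter_atTop (μ := μ) (s := fun n : ℕ => {x | (n : ℝ≥0∞) < f x})
    (fun _ => hf.nullMeasurable measurableSet_Ioi) (antitone_superlevel f)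
    ⟨1, by simpa using (hAC.measure_superlevel_lt_top hf hX one_pos).ne⟩
  rwa [measure_iInter_superlevel hf hX] at this

variable (X)

/-- On sets of small measure, the `L^p` mean is controlled by the norm of `X`, relative to the norm
of the indicator function. -/
def ControlsLpMean (p : ℝ) : Prop :=
  ∃ (c : ℝ≥0) (δ : ℝ≥0∞), 0 < δ ∧ ∀ (E : Set α) (f : α → ℝ≥0∞), NullMeasurableSet E μ →
    0 < μ E → μ E < δ → AEMeasurable f μ → (∀ x ∉ E, f x = 0) → X f < ∞ →
    X (E.indicator 1) * (∫⁻ x, f x ^ p ∂μ) ^ (1 / p) ≤ c * μ E ^ (1 / p) * X f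

end RISpace

/-! ### Lipschitz approximation -/

section Approximation

variable {P : Type*} [MetricSpace P] [MeasurableSpace P] [BorelSpace P] {μ : Measure P}
  {X : RISpace μ} {C : ℝ≥0} {p : ℝ}

/-- The set where the maximal function of `g` is large is small in the sense of `X`. -/
theorem RISpace.ControlsLpMean.exists_maximal_le (hW : X.ControlsLpMean p)
    (hball : BallsFinitePos μ)
    (hC : ∀ (x : P) (r : ℝ), 0 < r → μ (Metric.ball x (2 * r)) ≤ C * μ (Metric.ball x r))
    (hp : 1 ≤ p) (hAC : X.HasACNorm) {g : P → ℝ≥0∞} (hg : Measurable g) (hgX : X g < ∞)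
    {ε δ : ℝ≥0∞} (hε : 0 < ε) (hδ : 0 < δ) :
    ∃ (Λ : ℝ≥0) (A : Set P), 1 ≤ Λ ∧ MeasurableSet A ∧ μ A < δ ∧
      Λ * X (A.indicator 1) < ε ∧ ∀ x ∉ A, ∀ r > 0,
        ∫⁻ y in Metric.ball x r, g y ^ p ∂μ ≤ (2 * Λ : ℝ≥0∞) ^ p * μ (Metric.ball x r) := by
  have := hball.sigmaFinite
  obtain ⟨c, δ', hδ', hW⟩ := hW
  have hp0 : 0 < p := by linarith
  set F : ℕ → Set P := fun n => {x | (n : ℝ≥0∞) < g x} with hF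
  have hFm : ∀ n, MeasurableSet (F n) := fun n => hg measurableSet_Ioi
  set f : ℕ → P → ℝ≥0∞ := fun n => (F n).indicator g with hf
  have hfm : ∀ n, Measurable (f n) := fun n => hg.indicator (hFm n)
  have hfX : ∀ n, X (f n) < ∞ := fun n =>
    (X.mono _ _ (hfm n).aemeasurable hg.aemeasurable
      (Eventually.of_forall (indicator_le_self _ _))).trans_lt hgX
  have hf0 : ∀ n, ∀ x ∉ F n, f n x = 0 := fun n x hx => indicator_of_notMem hx _
  set I : ℕ → ℝ≥0∞ := fun n => ∫⁻ x, f n x ^ p ∂μ with hI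
  obtain ⟨n₀, hn₀⟩ :=
    ((hAC.tendsto_measure_superlevel hg.aemeasurable hgX).eventually (gt_mem_nhds hδ')).exists
  -- `{g > n₀}` is small enough for the control property, so `f n₀` is `p`-integrable although `g`
  -- need not be.
  have hIfin : I n₀ < ∞ := by
    rcases eq_zero_or_pos (μ (F n₀)) with h0 | hpos
    · have : I n₀ = 0 := by
        rw [hI]
        simp only
        rw [lintegral_eq_zero_iff (by fun_prop)]
        filter_upwards [measure_eq_zero_iff_ae_notMem.1 h0] with x hx
        simp [hf0 n₀ x hx, hp0]
      rw [this]; exact ENNReal.zero_lt_top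
    · have h1 := hW (F n₀) (f n₀) (hFm n₀).nullMeasurableSet hpos hn₀ (hfm n₀).aemeasurable
        (hf0 n₀) (hfX n₀)
      by_contra hnot
      have htop : ∫⁻ x, f n₀ x ^ p ∂μ = ∞ := not_lt_top_iff.1 hnot
      rw [htop, ENNReal.top_rpow_of_pos (by positivity),
        ENNReal.mul_top (X.indicator_one_pos (hFm n₀).nullMeasurableSet hpos.ne').ne'] at h1
      refine (h1.trans_lt (ENNReal.mul_lt_top (ENNReal.mul_lt_top ENNReal.coe_lt_top ?_)
        (hfX n₀))).false
      refine ENNReal.rpow_lt_top_of_nonneg (by positivity) ?_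
      exact ne_top_of_lt hn₀
  have hImono : ∀ n, n₀ ≤ n → I n ≤ I n₀ := fun n hn => lintegral_mono fun x => by
    refine ENNReal.rpow_le_rpow ?_ hp0.le
    exact indicator_le_indicator_of_subset (RISpace.antitone_superlevel g hn) (fun _ => zero_le) x
  set S : ℕ → Set P := fun n => F n ∪ {x | ∃ r > 0, (n : ℝ≥0∞) ^ p * μ (Metric.ball x r) <
    ∫⁻ y in Metric.ball x r, f n y ^ p ∂μ} with hS
  -- A measurable hull of the same measure replaces the maximal superlevel set.
  set A : ℕ → Set P := fun n => toMeasurable μ (S n) with hA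
  have hAm : ∀ n, MeasurableSet (A n) := fun n => measurableSet_toMeasurable _ _
  have hSA : ∀ n, S n ⊆ A n := fun n => subset_toMeasurable _ _
  -- `1` comes from Chebyshev on `F n`, `C ^ 3` from the weak type estimate.
  set D : ℝ≥0 := 1 + C ^ 3 with hD
  have hAle : ∀ n : ℕ, (n : ℝ≥0∞) ^ p * μ (A n) ≤ D * I n := by
    intro n
    have h1 : (n : ℝ≥0∞) ^ p * μ (F n) ≤ I n := by
      calc (n : ℝ≥0∞) ^ p * μ (F n) ≤ (n : ℝ≥0∞) ^ p * μ {x | (n : ℝ≥0∞) ^ p ≤ f n x ^ p} := by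
            gcongr
            intro x hx
            rw [mem_ofPred_eq, hf]
            simp only
            rw [indicator_of_mem hx]
            exact ENNReal.rpow_le_rpow (le_of_lt hx) hp0.le
        _ ≤ I n := mul_meas_ge_le_lintegral (by fun_prop) _
    have h2 := mul_measure_le_lintegral_of_maximal hball hC (fun y => f n y ^ p) ((n : ℝ≥0∞) ^ p)
    rw [hA]
    simp only
    rw [measure_toMeasurable]
    calc (n : ℝ≥0∞) ^ p * μ (S n) ≤ (n : ℝ≥0∞) ^ p * (μ (F n) + μ {x | ∃ r > 0,
          (n : ℝ≥0∞) ^ p * μ (Metric.ball x r) < ∫⁻ y in Metric.ball x r, f n y ^ p ∂μ}) := by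
          gcongr
          exact measure_union_le _ _
      _ ≤ I n + C ^ 3 * I n := by
          rw [mul_add]
          exact add_le_add h1 h2
      _ = D * I n := by rw [hD]; push_cast; ring
  have hAlim : Tendsto (fun n => μ (A n)) atTop (𝓝 0) := by
    have hlim : Tendsto (fun n : ℕ => D * I n₀ / (n : ℝ≥0∞) ^ p) atTop (𝓝 0) := by
      have h1 : Tendsto (fun n : ℕ => (n : ℝ≥0∞) ^ p) atTop (𝓝 ∞) := by
        have := (ENNReal.continuous_rpow_const (y := p)).tendsto (∞ : ℝ≥0∞)
        rw [ENNReal.top_rpow_of_pos hp0] at this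
        exact this.comp ENNReal.tendsto_nat_nhds_top
      have := ENNReal.Tendsto.const_div (m := fun n : ℕ => (n : ℝ≥0∞) ^ p) (a := D * I n₀) h1
        (Or.inr (ENNReal.mul_ne_top ENNReal.coe_ne_top hIfin.ne))
      simpa using this
    refine tendsto_of_tendsto_of_tendsto_of_le_of_le' tendsto_const_nhds hlim
      (Eventually.of_forall fun _ => zero_le) ?_
    filter_upwards [eventually_ge_atTop (max n₀ 1)] with n hn
    rw [ENNReal.le_div_iff_mul_le, mul_comm]
    · exact (hAle n).trans (mul_le_mul_right (hImono n ((le_max_left _ _).trans hn)) _)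
    · left
      have : (n : ℝ≥0∞) ≠ 0 := by
        have := (le_max_right n₀ 1).trans hn
        positivity
      simp [this]
    · left
      exact ENNReal.rpow_ne_top_of_nonneg hp0.le (ENNReal.natCast_ne_top n)
  have hXlim : Tendsto (fun n : ℕ => c * (D : ℝ≥0∞) ^ (1 / p) * X (f n)) atTop (𝓝 0) := by
    have := ENNReal.Tendsto.const_mul (a := c * (D : ℝ≥0∞) ^ (1 / p))
      (hAC.tendsto_indicator_superlevel hg.aemeasurable hgX)
      (Or.inr (ENNReal.mul_ne_top ENNReal.coe_ne_top
        (ENNReal.rpow_ne_top_of_nonneg (by positivity) ENNReal.coe_ne_top)))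
    rwa [mul_zero] at this
  obtain ⟨n, hnδ, hnX, hn⟩ := ((hAlim.eventually (gt_mem_nhds (lt_min hδ hδ'))).and
    ((hXlim.eventually (gt_mem_nhds hε)).and (eventually_ge_atTop (max n₀ 1)))).exists
  have hn1 : 1 ≤ n := (le_max_right _ _).trans hn
  have hn0 : n₀ ≤ n := (le_max_left _ _).trans hn
  refine ⟨n, A n, by exact_mod_cast hn1, hAm n, hnδ.trans_le (min_le_left _ _), ?_, ?_⟩
  · rcases eq_zero_or_pos (μ (A n)) with h0 | hpos
    · rw [X.indicator_one_eq_zero h0, mul_zero]; exact hε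
    refine lt_of_le_of_lt ?_ hnX
    have hnp : (n : ℝ≥0∞) ^ p ≠ 0 := by
      have : (n : ℝ≥0∞) ≠ 0 := by positivity
      simp [this]
    -- Needed to cancel `I n ^ (1 / p)`, which appears on both sides when the control property on `A
    -- n` is combined with the weak type bound `h2`.
    have hIn : I n ≠ 0 := by
      intro h0
      have := hAle n
      rw [h0, mul_zero, nonpos_iff_eq_zero, mul_eq_zero] at this
      exact this.elim hnp hpos.ne'
    have hIn' : I n ≠ ∞ := ((hImono n hn0).trans_lt hIfin).ne
    have h1 := hW (A n) (f n) (hAm n).nullMeasurableSet hpos (hnδ.trans_le (min_le_right _ _))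
      (hfm n).aemeasurable (fun x hx => hf0 n x fun h => hx (hSA n (Or.inl h))) (hfX n)
    have h2 : (n : ℝ≥0∞) * μ (A n) ^ (1 / p) ≤ (D : ℝ≥0∞) ^ (1 / p) * I n ^ (1 / p) := by
      have := ENNReal.rpow_le_rpow (hAle n) (show 0 ≤ 1 / p by positivity)
      rwa [ENNReal.mul_rpow_of_nonneg _ _ (by positivity),
        ENNReal.mul_rpow_of_nonneg _ _ (by positivity), ← ENNReal.rpow_mul,
        mul_one_div_cancel hp0.ne', ENNReal.rpow_one] at this
    have hR : I n ^ (1 / p) ≠ 0 := by simp [hIn, hIn']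
    have hR' : I n ^ (1 / p) ≠ ∞ := ENNReal.rpow_ne_top_of_nonneg (by positivity) hIn'
    rw [← ENNReal.mul_le_mul_iff_left hR hR']
    calc ((n : ℝ≥0) : ℝ≥0∞) * X ((A n).indicator 1) * I n ^ (1 / p)
        = n * (X ((A n).indicator 1) * I n ^ (1 / p)) := by push_cast; ring
      _ ≤ n * (c * μ (A n) ^ (1 / p) * X (f n)) := by gcongr
      _ = c * (n * μ (A n) ^ (1 / p)) * X (f n) := by ring
      _ ≤ c * ((D : ℝ≥0∞) ^ (1 / p) * I n ^ (1 / p)) * X (f n) := by gcongr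
      _ = _ := by ring
  · intro x hx r hr
    have hx' : ∫⁻ y in Metric.ball x r, f n y ^ p ∂μ ≤ (n : ℝ≥0∞) ^ p * μ (Metric.ball x r) := by
      by_contra hlt
      exact hx (hSA n (Or.inr ⟨r, hr, not_le.1 hlt⟩))
    -- Pointwise `g ^ p ≤ f n ^ p + n ^ p`, and `2 ≤ 2 ^ p` absorbs the two equal bounds.
    calc ∫⁻ y in Metric.ball x r, g y ^ p ∂μ
        ≤ ∫⁻ y in Metric.ball x r, (f n y ^ p + (n : ℝ≥0∞) ^ p) ∂μ := by
          refine lintegral_mono fun y => ?_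
          by_cases hy : y ∈ F n
          · simp only [hf, indicator_of_mem hy]
            exact le_self_add
          · refine le_trans ?_ le_add_self
            exact ENNReal.rpow_le_rpow (not_lt.1 hy) hp0.le
      _ = ∫⁻ y in Metric.ball x r, f n y ^ p ∂μ + (n : ℝ≥0∞) ^ p * μ (Metric.ball x r) := by
          rw [lintegral_add_right _ measurable_const, setLIntegral_const]
      _ ≤ (n : ℝ≥0∞) ^ p * μ (Metric.ball x r) + (n : ℝ≥0∞) ^ p * μ (Metric.ball x r) := by
          gcongr
      _ = 2 * (n : ℝ≥0∞) ^ p * μ (Metric.ball x r) := by ring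
      _ ≤ (2 * n : ℝ≥0∞) ^ p * μ (Metric.ball x r) := by
          gcongr
          rw [ENNReal.mul_rpow_of_nonneg _ _ hp0.le]
          gcongr
          calc (2 : ℝ≥0∞) = 2 ^ (1 : ℝ) := (ENNReal.rpow_one _).symm
            _ ≤ 2 ^ p := ENNReal.rpow_le_rpow_of_exponent_le (by norm_num) hp
      _ = _ := by push_cast; rfl

/-- The Poincaré inequality bounds the oscillation where the maximal function of the upper gradient
is bounded. -/
theorem oscillation_le_of_poincare {P : Type*} [MetricSpace P] [MeasurableSpace P]
    {μ : Measure P} (hball : BallsFinitePos μ) (hp : 1 ≤ p) {c : ℝ≥0} {l : ℝ}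
    (hl : 1 ≤ l) {u : P → ℝ} (hu : ∀ (y : P) (R : ℝ), IntegrableOn u (Metric.ball y R) μ)
    {g : P → ℝ≥0∞} {x : P}
    (hPI : ∀ r > 0, ⨍⁻ y in Metric.ball x r, ‖u y - ⨍ z in Metric.ball x r, u z ∂μ‖ₑ ∂μ ≤
        c * ENNReal.ofReal (Metric.diam (Metric.ball x r)) *
          (⨍⁻ y in Metric.ball x (l * r), g y ^ p ∂μ) ^ (1 / p)) {Λ : ℝ≥0}
    (hx : ∀ r > 0,
      ∫⁻ y in Metric.ball x r, g y ^ p ∂μ ≤ (2 * Λ : ℝ≥0∞) ^ p * μ (Metric.ball x r))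
    {r : ℝ} (hr : 0 < r) :
    ⨍ y in Metric.ball x r, |u y - ⨍ z in Metric.ball x r, u z ∂μ| ∂μ ≤ 4 * c * Λ * r := by
  have hp0 : 0 < p := by linarith
  have hlr : 0 < l * r := by positivity
  have h1 : (⨍⁻ y in Metric.ball x (l * r), g y ^ p ∂μ) ^ (1 / p) ≤ 2 * Λ := by
    rw [setLAverage_eq]
    have h2 : (∫⁻ y in Metric.ball x (l * r), g y ^ p ∂μ) / μ (Metric.ball x (l * r)) ≤
        (2 * Λ : ℝ≥0∞) ^ p := by
      rw [ENNReal.div_le_iff (hball x _ hlr).1.ne' (hball x _ hlr).2.ne]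
      exact hx _ hlr
    calc _ ≤ ((2 * Λ : ℝ≥0∞) ^ p) ^ (1 / p) := ENNReal.rpow_le_rpow h2 (by positivity)
      _ = _ := by rw [← ENNReal.rpow_mul, mul_one_div_cancel hp0.ne', ENNReal.rpow_one]
  have h2 : ⨍⁻ y in Metric.ball x r, ‖u y - ⨍ z in Metric.ball x r, u z ∂μ‖ₑ ∂μ ≤
      ENNReal.ofReal (4 * c * Λ * r) := by
    refine (hPI r hr).trans ?_
    calc _ ≤ c * ENNReal.ofReal (2 * r) * (2 * Λ) := by
          gcongr
          exact Metric.diam_ball hr.le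
      _ = _ := by
          rw [← ENNReal.ofReal_coe_nnreal, ← ENNReal.ofReal_coe_nnreal (p := Λ),
            ← ENNReal.ofReal_ofNat, ← ENNReal.ofReal_mul (by positivity),
            ← ENNReal.ofReal_mul (by positivity), ← ENNReal.ofReal_mul (by positivity)]
          congr 1
          ring
  have hm : AEStronglyMeasurable (fun y => u y - ⨍ z in Metric.ball x r, u z ∂μ)
      (((μ.restrict (Metric.ball x r)) univ)⁻¹ • μ.restrict (Metric.ball x r)) :=
    ((hu x r).aestronglyMeasurable.sub aestronglyMeasurable_const).smul_measure _
  have h3 := integral_norm_eq_lintegral_enorm hm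
  simp only [Real.norm_eq_abs] at h3
  rw [average, h3]
  exact ENNReal.toReal_le_of_le_ofReal (by positivity) h2

/-- Off a set `A'` the function is Lipschitz with constant `D * Λ`, where `Λ * ‖χ_A'‖_X` is small.
The extension changes `u` only on `A'`, and by at most `2 * k`, so both the difference and its
cut-off upper gradient have small norm. -/
theorem exists_lipschitz_approx_of_bounded (hball : BallsFinitePos μ) (hdoubling : IsDoubling μ)
    (hp : 1 ≤ p) (hPI : IsPoincareSpace μ p) (hAC : X.HasACNorm) (hW : X.ControlsLpMean p)
    {u : P → ℝ} {k : ℝ≥0} (hk : ∀ x, |u x| ≤ k) (hu : AEMeasurable u μ) {g : P → ℝ≥0∞}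
    (hg : IsUpperGradient (fun x => (u x : EReal)) g) (hgX : X g < ∞) {ε : ℝ≥0∞} (hε : 0 < ε) :
    ∃ v : P → ℝ, (∃ K : ℝ≥0, LipschitzWith K v) ∧
      (∃ h, IsUpperGradient (fun x => ((u x - v x : ℝ) : EReal)) h ∧ X h < ε) ∧
      X (fun x => ENNReal.ofReal |u x - v x|) < ε := by
  wlog hεtop : ε ≠ ∞ generalizing ε
  · obtain ⟨v, h1, ⟨h, h2, h3⟩, h4⟩ := this (ε := 1) one_pos ENNReal.one_ne_top
    rw [not_ne_iff] at hεtop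
    subst hεtop
    exact ⟨v, h1, ⟨h, h2, h3.trans ENNReal.one_lt_top⟩, h4.trans ENNReal.one_lt_top⟩
  obtain ⟨C, hC⟩ := hdoubling
  obtain ⟨c, l, -, hl, hPI⟩ := hPI
  have hint : ∀ (y : P) (R : ℝ), IntegrableOn u (Metric.ball y R) μ := by
    intro y R
    rcases le_or_gt R 0 with hR | hR
    · simp [Metric.ball_eq_empty.2 hR]
    exact Measure.integrableOn_of_bounded (M := k) (hball y R hR).2.ne hu.aestronglyMeasurable
      (Eventually.of_forall hk)
  have hε4 : 0 < ε / 4 := ENNReal.div_pos hε.ne' (by simp)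
  -- The pointwise estimate applied with oscillation bound `4 * c * Λ * r`. `T` below dominates both
  -- `D`, for the gradient, and `2 * k`, for the function.
  set D : ℝ≥0 := (6 * C + 2 * C ^ 2) * (4 * c) with hD
  set T : ℝ≥0 := D + 2 * k + 1 with hT
  have hη : 0 < ε / 4 / T := ENNReal.div_pos hε4.ne' ENNReal.coe_ne_top
  have hTη : T * (ε / 4 / T) ≤ ε / 4 := ENNReal.mul_div_le
  obtain ⟨δ, hδ, hδX⟩ := hAC.exists_indicator_lt hg.1.aemeasurable hgX hε4
  obtain ⟨Λ, A, hΛ, hA, hAδ, hAX, hAg⟩ :=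
    hW.exists_maximal_le hball hC hp hAC hg.1 hgX hη hδ
  have hleb := ae_tendsto_setAverage_ball hball hC hint
  -- Adding the non-Lebesgue points to `A` costs nothing: they form a null set, so `‖χ_A'‖_X =
  -- ‖χ_A‖_X`.
  set N : Set P := {x | ¬ Tendsto (fun r : ℝ => ⨍ y in Metric.ball x r, u y ∂μ) (𝓝[>] 0)
    (𝓝 (u x))} with hN
  have hN0 : μ N = 0 := ae_iff.1 hleb
  set A' : Set P := A ∪ toMeasurable μ N with hA'
  have hA'm : MeasurableSet A' := hA.union (measurableSet_toMeasurable _ _)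
  have hμA' : μ A' = μ A := by
    refine le_antisymm ((measure_union_le _ _).trans_eq ?_) (measure_mono subset_union_left)
    rw [measure_toMeasurable, hN0, add_zero]
  have hXA' : X (A'.indicator 1) = X (A.indicator 1) :=
    X.indicator_one_congr hA'm.nullMeasurableSet hA.nullMeasurableSet hμA'
  have hlip : LipschitzOnWith (D * Λ) u A'ᶜ := by
    refine LipschitzOnWith.of_dist_le_mul fun x hx y hy => ?_
    have hgood : ∀ z ∈ A'ᶜ, Tendsto (fun r : ℝ => ⨍ y in Metric.ball z r, u y ∂μ) (𝓝[>] 0)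
        (𝓝 (u z)) := by
      intro z hz
      by_contra hcon
      exact hz (Or.inr (subset_toMeasurable μ N hcon))
    have hosc : ∀ z ∈ A'ᶜ, ∀ r > 0,
        ⨍ y in Metric.ball z r, |u y - ⨍ w in Metric.ball z r, u w ∂μ| ∂μ ≤ 4 * c * Λ * r :=
      fun z hz r hr => oscillation_le_of_poincare hball hp hl hint
        (fun r hr => hPI z r hr u hint g hg) (hAg z fun h => hz (Or.inl h)) hr
    have := abs_sub_le_of_oscillation hball hC hint (hgood x hx) (hgood y hy) (hosc x hx)
      (hosc y hy)
    rw [Real.dist_eq]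
    refine this.trans_eq ?_
    rw [hD]
    push_cast
    ring
  obtain ⟨v₀, hv₀, heq⟩ := hlip.extend_real
  -- Cutting at `±k` preserves the agreement with `u` off `A'`, because `|u| ≤ k`, and bounds `|u -
  -- v|` on `A'`.
  set v : P → ℝ := fun x => max (-k) (min k (v₀ x)) with hv
  have hvlip : LipschitzWith (D * Λ) v := (hv₀.const_min _).const_max _
  have hvk : ∀ x, |v x| ≤ k := fun x => abs_le.2
    ⟨le_max_left _ _, max_le (by linarith [k.2]) (min_le_left _ _)⟩
  have hvu : ∀ x ∉ A', u x - v x = 0 := by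
    intro x hx
    have h1 := heq (show x ∈ A'ᶜ from hx)
    have h2 := abs_le.1 (hk x)
    simp only [hv, ← h1, min_eq_right h2.2, max_eq_right h2.1, sub_self]
  have hvm : Measurable v := hvlip.continuous.measurable
  refine ⟨v, ⟨_, hvlip⟩, ?_, ?_⟩
  · obtain ⟨η, hη0, hηX⟩ : ∃ η : ℝ≥0, 0 < η ∧ η * X g < ε / 4 := by
      obtain ⟨η, hη1, hη2⟩ := ENNReal.exists_nnreal_pos_mul_lt hgX.ne hε4.ne'
      exact ⟨η, hη1, hη2⟩
    have hug : IsUpperGradient (fun x => ((u x - v x : ℝ) : EReal))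
        (fun x => g x + ((D * Λ : ℝ≥0) : ℝ≥0∞)) := by
      refine hg.of_abs_sub_le_add hvlip.isUpperGradient_const fun x y => ?_
      rw [EReal.abs_coe_sub_coe, EReal.abs_coe_sub_coe, EReal.abs_coe_sub_coe,
        ← ENNReal.ofReal_add (abs_nonneg _) (abs_nonneg _)]
      refine ENNReal.ofReal_le_ofReal ?_
      calc |u x - v x - (u y - v y)| = |(u x - u y) - (v x - v y)| := by ring_nf
        _ ≤ _ := abs_sub _ _
    -- The controlling function is `η * g`: small in norm, yet `g + D * Λ` is at most a constant
    -- multiple of `η * g + 1`.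
    have hcut := hug.indicator_add (k := fun x => η * g x) (hg.1.const_mul _)
      (c := η⁻¹ + D * Λ) (fun x => by
        have h1 : g x = (η⁻¹ : ℝ≥0) * (η * g x) := by
          rw [← mul_assoc, ← ENNReal.coe_mul, inv_mul_cancel₀ hη0.ne', ENNReal.coe_one, one_mul]
        calc g x + ((D * Λ : ℝ≥0) : ℝ≥0∞)
            ≤ (η⁻¹ : ℝ≥0) * (η * g x + 1) + ((D * Λ : ℝ≥0) : ℝ≥0∞) * (η * g x + 1) := by
              refine add_le_add ?_ ?_
              · conv_lhs => rw [h1]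
                gcongr
                exact le_self_add
              · conv_lhs => rw [← mul_one ((D * Λ : ℝ≥0) : ℝ≥0∞)]
                gcongr
                exact le_add_self
          _ = _ := by push_cast; ring) hA'm
      (fun x hx => by rw [hvu x hx]; rfl)
    refine ⟨_, hcut, ?_⟩
    have m1 : AEMeasurable (A'.indicator g) μ := (hg.1.indicator hA'm).aemeasurable
    have m2 : AEMeasurable (A'.indicator fun _ => ((D * Λ : ℝ≥0) : ℝ≥0∞)) μ :=
      (measurable_const.indicator hA'm).aemeasurable
    have m3 : AEMeasurable (A'.indicator fun x => g x + ((D * Λ : ℝ≥0) : ℝ≥0∞)) μ :=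
      ((hg.1.add_const _).indicator hA'm).aemeasurable
    have e1 : X (A'.indicator g) < ε / 4 :=
      hδX A' hA'm.nullMeasurableSet (hμA' ▸ hAδ)
    have e2 : X (A'.indicator fun _ => ((D * Λ : ℝ≥0) : ℝ≥0∞)) ≤ ε / 4 := by
      calc _ ≤ ((D * Λ : ℝ≥0) : ℝ≥0∞) * X (A'.indicator 1) :=
            X.le_coe_mul_indicator_one hA'm.nullMeasurableSet m2
              (fun x hx => by rw [indicator_of_mem hx]) fun x hx => indicator_of_notMem hx _
        _ = D * (Λ * X (A.indicator 1)) := by rw [hXA']; push_cast; ring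
        _ ≤ T * (ε / 4 / T) := by
            gcongr
            rw [hT, add_assoc]; exact le_self_add
        _ ≤ ε / 4 := hTη
    calc X (fun x => A'.indicator (fun x => g x + ((D * Λ : ℝ≥0) : ℝ≥0∞)) x + η * g x)
        ≤ X (A'.indicator fun x => g x + ((D * Λ : ℝ≥0) : ℝ≥0∞)) + X (fun x => η * g x) :=
          X.add_le _ _ m3 (hg.1.aemeasurable.const_mul _)
      _ ≤ (X (A'.indicator g) + X (A'.indicator fun _ => ((D * Λ : ℝ≥0) : ℝ≥0∞))) + η * X g := by
          gcongr
          · rw [indicator_add]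
            exact X.add_le _ _ m1 m2
          · exact (X.smul η g hg.1.aemeasurable).le
      _ < ε / 4 + ε / 4 + ε / 4 := by
          refine ENNReal.add_lt_add (ENNReal.add_lt_add_of_lt_of_le ?_ e1 e2) hηX
          exact (e2.trans_lt (ENNReal.div_lt_top hεtop (by simp))).ne
      _ ≤ ε / 4 + ε / 4 + ε / 4 + ε / 4 := le_self_add
      _ = ε := by
          have : ε / 4 + ε / 4 + ε / 4 + ε / 4 = 4 * (ε / 4) := by ring
          rw [this, ENNReal.mul_div_cancel (by simp) (by simp)]
  · calc X (fun x => ENNReal.ofReal |u x - v x|) ≤ ((2 * k : ℝ≥0) : ℝ≥0∞) * X (A'.indicator 1) := by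
          refine X.le_coe_mul_indicator_one hA'm.nullMeasurableSet
            (hu.sub hvm.aemeasurable).abs.ennreal_ofReal (fun x _ => ?_)
            fun x hx => by simp [hvu x hx]
          rw [← ENNReal.ofReal_coe_nnreal]
          refine ENNReal.ofReal_le_ofReal ?_
          push_cast
          linarith [abs_sub (u x) (v x), hk x, hvk x]
      -- Here `1 ≤ Λ` is used.
      _ ≤ T * (Λ * X (A.indicator 1)) := by
          rw [hXA']
          gcongr
          · rw [hT]
            exact le_add_right (le_add_self)
          · exact le_mul_of_one_le_left zero_le (by exact_mod_cast hΛ)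
      _ ≤ T * (ε / 4 / T) := by gcongr
      _ ≤ ε / 4 := hTη
      _ < ε := ENNReal.div_lt_of_lt_mul (by
          calc ε = ε * 1 := (mul_one _).symm
            _ < ε * 4 := by
              rw [ENNReal.mul_lt_mul_iff_right hε.ne' hεtop]; norm_num)

end Approximation

/-! ### Truncation -/

/-- The truncation of an extended real number at the levels `±k`. -/
def EReal.truncate (k : ℝ≥0) (a : EReal) : ℝ :=
  (max (((-k : ℝ) : EReal)) (min ((k : ℝ) : EReal) a)).toReal

namespace EReal

variable (k : ℝ≥0)

theorem truncate_coe (a : ℝ) : truncate k a = max (-k : ℝ) (min k a) := by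
  rw [truncate, ← EReal.coe_strictMono.monotone.map_min, ← EReal.coe_strictMono.monotone.map_max,
    EReal.toReal_coe]

theorem truncate_top : truncate k ⊤ = k := by
  have h : ((-k : ℝ) : EReal) ≤ ((k : ℝ) : EReal) :=
    EReal.coe_le_coe_iff.2 (by linarith [k.2])
  rw [truncate, min_top_right, max_eq_right h, EReal.toReal_coe]

theorem truncate_bot : truncate k ⊥ = -k := by
  rw [truncate, min_bot_right, max_bot_right, EReal.toReal_coe]

theorem measurable_truncate : Measurable (truncate k) :=
  (measurable_const.max (measurable_const.min measurable_id)).ereal_toReal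

theorem abs_truncate_le (a : EReal) : |truncate k a| ≤ k := by
  have hk : (0 : ℝ) ≤ k := k.coe_nonneg
  induction a with
  | bot => rw [truncate_bot, abs_neg, abs_of_nonneg hk]
  | top => rw [truncate_top, abs_of_nonneg hk]
  | coe a =>
    rw [truncate_coe]
    exact abs_le.2 ⟨le_max_left _ _, max_le (by linarith) (min_le_left _ _)⟩

theorem abs_truncate_coe_le (a : EReal) : (truncate k a : EReal).abs ≤ a.abs := by
  have hk : (0 : ℝ) ≤ k := k.2
  induction a with
  | bot => simp
  | top => simp
  | coe a =>
    rw [truncate_coe, EReal.abs_def, EReal.abs_def]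
    refine ENNReal.ofReal_le_ofReal (abs_le.2 ⟨?_, ?_⟩)
    · exact le_max_of_le_right (le_min (by linarith [abs_nonneg a]) (neg_abs_le a))
    · exact max_le (by linarith [abs_nonneg a]) ((min_le_right _ _).trans (le_abs_self a))

theorem abs_truncate_sub_le (a b : EReal) :
    ((truncate k a : EReal) - truncate k b).abs ≤ (a - b).abs := by
  by_cases h : (a - b).abs < ∞
  · obtain ⟨x, y, rfl, rfl⟩ := EReal.exists_real_of_abs_sub_lt_top h
    rw [EReal.abs_coe_sub_coe, EReal.abs_coe_sub_coe, truncate_coe, truncate_coe]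
    refine ENNReal.ofReal_le_ofReal ((abs_max_sub_max_le_max _ _ _ _).trans ?_)
    refine max_le (by simp) ((abs_min_sub_min_le_max _ _ _ _).trans ?_)
    simp
  · rw [not_lt_top_iff.1 h]; exact le_top

/-- On the reals both the truncation and its complement `a - truncate k a` are nondecreasing, so
increments of the complement lie between `0` and those of `a`. -/
theorem abs_sub_truncate_sub_le (a b : EReal) :
    ((a - truncate k a) - (b - truncate k b)).abs ≤ (a - b).abs := by
  by_cases h : (a - b).abs < ∞
  · obtain ⟨x, y, rfl, rfl⟩ := EReal.exists_real_of_abs_sub_lt_top h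
    rw [← EReal.coe_sub, ← EReal.coe_sub, EReal.abs_coe_sub_coe, EReal.abs_coe_sub_coe,
      truncate_coe, truncate_coe]
    refine ENNReal.ofReal_le_ofReal ?_
    have hk : (0 : ℝ) ≤ k := k.2
    wlog hxy : y ≤ x generalizing x y
    · rw [abs_sub_comm, abs_sub_comm x]
      exact this y x (by rw [EReal.abs_coe_sub_coe]; exact ENNReal.ofReal_lt_top) (by linarith)
    have h1 : min (k : ℝ) x - min (k : ℝ) y ≤ x - y := by
      rcases le_total (k : ℝ) x with h1 | h1 <;> rcases le_total (k : ℝ) y with h2 | h2 <;>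
        simp only [min_eq_left, min_eq_right, h1, h2] <;> linarith
    have h2 : min (k : ℝ) y ≤ min (k : ℝ) x := min_le_min le_rfl hxy
    have h3 : max (-k : ℝ) (min k x) - max (-k : ℝ) (min k y) ≤ min (k : ℝ) x - min (k : ℝ) y := by
      rcases le_total (-k : ℝ) (min k x) with h1 | h1 <;>
        rcases le_total (-k : ℝ) (min k y) with h2 | h2 <;>
        simp only [max_eq_left, max_eq_right, h1, h2] <;> linarith
    have h4 : max (-k : ℝ) (min k y) ≤ max (-k : ℝ) (min k x) := max_le_max le_rfl h2
    rw [abs_of_nonneg (show (0 : ℝ) ≤ x - y by linarith), abs_of_nonneg] <;> linarith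
  · rw [not_lt_top_iff.1 h]; exact le_top

theorem sub_truncate_eq_zero {a : EReal} (h : a.abs ≤ k) : a - truncate k a = 0 := by
  induction a with
  | bot => simp at h
  | top => simp at h
  | coe a =>
    rw [EReal.abs_def, ← ENNReal.ofReal_coe_nnreal, ENNReal.ofReal_le_ofReal_iff k.coe_nonneg,
      abs_le] at h
    rw [truncate_coe, min_eq_right h.2, max_eq_right h.1, ← EReal.coe_sub, _root_.sub_self,
      EReal.coe_zero]

theorem abs_sub_truncate_le (a : EReal) : (a - truncate k a).abs ≤ a.abs := by
  have := abs_sub_truncate_sub_le k a 0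
  rwa [sub_truncate_eq_zero k (a := 0) (by simp), sub_zero, sub_zero] at this

theorem sub_coe_eq_sub_truncate_add (a : EReal) (b : ℝ) :
    a - b = (a - truncate k a) + ((truncate k a - b : ℝ) : EReal) := by
  induction a with
  | bot => simp
  | top => rw [EReal.top_sub_coe, EReal.top_sub_coe, EReal.top_add_coe]
  | coe a => norm_cast; ring

end EReal

/-! ### Density of Lipschitz functions -/

section Density

variable {P : Type*} [MetricSpace P] [MeasurableSpace P] {μ : Measure P}
  {X : RISpace μ} {p : ℝ}

/-- The remainder after truncation has `g` as an upper gradient and vanishes off `{|u| > n}`, whose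
measure tends to `0`. Cutting `g` off to that set, up to `η * g`, gives an upper gradient of small
norm. -/
theorem exists_truncate_approx [SigmaFinite μ] (hAC : X.HasACNorm) {u : P → EReal}
    (hu : AEMeasurable u μ) (huX : X (fun x => (u x).abs) < ∞) {g : P → ℝ≥0∞}
    (hg : IsUpperGradient u g) (hgX : X g < ∞) {ε : ℝ≥0∞} (hε : 0 < ε) :
    ∃ k : ℝ≥0, X (fun x => (u x - EReal.truncate k (u x)).abs) < ε ∧
      ∃ h, IsUpperGradient (fun x => u x - EReal.truncate k (u x)) h ∧ X h < ε := by
  have hε2 : 0 < ε / 2 := ENNReal.half_pos hε.ne'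
  have hum : AEMeasurable (fun x => (u x).abs) μ := EReal.measurable_abs.comp_aemeasurable hu
  obtain ⟨δ, hδ, hδX⟩ := hAC.exists_indicator_lt hg.1.aemeasurable hgX hε2
  obtain ⟨n, hn1, hn2⟩ := (((hAC.tendsto_indicator_superlevel hum huX).eventually
    (gt_mem_nhds hε)).and ((hAC.tendsto_measure_superlevel hum huX).eventually
    (gt_mem_nhds hδ))).exists
  have hFm : NullMeasurableSet {x | (n : ℝ≥0∞) < (u x).abs} μ :=
    hum.nullMeasurable measurableSet_Ioi
  have hzero : ∀ x, ¬ (n : ℝ≥0∞) < (u x).abs → u x - EReal.truncate n (u x) = 0 := fun x hx =>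
    EReal.sub_truncate_eq_zero _ (by simpa using hx)
  have hwm : AEMeasurable (fun x => (u x - EReal.truncate n (u x)).abs) μ := by
    refine EReal.measurable_abs.comp_aemeasurable ?_
    exact (measurable_id.sub
      (EReal.measurable_truncate n).coe_real_ereal).comp_aemeasurable hu
  refine ⟨n, lt_of_le_of_lt (X.mono _ _ hwm (hum.indicator₀ hFm)
    (Eventually.of_forall fun x => ?_)) hn1, ?_⟩
  · by_cases hx : (n : ℝ≥0∞) < (u x).abs
    · rw [indicator_of_mem (show x ∈ {x | (n : ℝ≥0∞) < (u x).abs} from hx)]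
      exact EReal.abs_sub_truncate_le _ _
    · simp only [hzero x hx, EReal.abs_zero]
      exact zero_le
  · obtain ⟨η, hη0, hηX⟩ := ENNReal.exists_nnreal_pos_mul_lt hgX.ne hε2.ne'
    set A := toMeasurable μ {x | (n : ℝ≥0∞) < (u x).abs} with hA
    have hAm : MeasurableSet A := measurableSet_toMeasurable _ _
    refine ⟨_, (hg.of_abs_sub_le fun x y => EReal.abs_sub_truncate_sub_le n (u x)
      (u y)).indicator_add (k := fun x => η * g x) (hg.1.const_mul _) (c := η⁻¹) (fun x => ?_) hAm
      (fun x hx => hzero x fun h => hx (subset_toMeasurable _ _ h)), ?_⟩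
    · calc g x = (η⁻¹ : ℝ≥0) * (η * g x) := by
            rw [← mul_assoc, ← ENNReal.coe_mul, inv_mul_cancel₀ hη0.ne', ENNReal.coe_one, one_mul]
        _ ≤ _ := by gcongr; exact le_self_add
    · calc _ ≤ X (A.indicator g) + X (fun x => η * g x) :=
            X.add_le _ _ (hg.1.indicator hAm).aemeasurable (hg.1.aemeasurable.const_mul _)
        _ < ε / 2 + ε / 2 := by
            refine ENNReal.add_lt_add (hδX A hAm.nullMeasurableSet ?_) ?_
            · rwa [hA, measure_toMeasurable]
            · rwa [X.smul η g hg.1.aemeasurable]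
        _ = ε := ENNReal.add_halves ε

theorem newtonianNorm_le {u : P → EReal} {h : P → ℝ≥0∞} (hu : IsUpperGradient u h) :
    newtonianNorm X u ≤ X (fun x => (u x).abs) + X h :=
  add_le_add le_rfl (iInf₂_le h hu)

/-- `u - v` splits into the truncation remainder and the error of approximating the truncation. Each
part contributes at most `ε / 4` to the function norm and to the gradient norm. -/
theorem RISpace.ControlsLpMean.lipschitzDenseInNewtonian [BorelSpace P] (hW : X.ControlsLpMean p)
    (hball : BallsFinitePos μ) (hdoubling : IsDoubling μ) (hp : 1 ≤ p)
    (hPI : IsPoincareSpace μ p) (hAC : X.HasACNorm) : LipschitzDenseInNewtonian X := by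
  intro u ⟨hum, hu⟩ ε hε
  have := hball.sigmaFinite
  have hε4 : 0 < ε / 4 := ENNReal.div_pos hε.ne' (by simp)
  obtain ⟨huX, hinf⟩ := ENNReal.add_lt_top.1 hu
  obtain ⟨g, hg⟩ := iInf_lt_iff.1 hinf
  obtain ⟨hg, hgX⟩ := iInf_lt_iff.1 hg
  have huabs : AEMeasurable (fun x => (u x).abs) μ := EReal.measurable_abs.comp_aemeasurable hum
  obtain ⟨k, hk, h₁, hh₁, hh₁X⟩ := exists_truncate_approx hAC hum huX hg hgX hε4
  have hTm : AEMeasurable (fun x => EReal.truncate k (u x)) μ :=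
    (EReal.measurable_truncate k).comp_aemeasurable hum
  have hgT : IsUpperGradient (fun x => (EReal.truncate k (u x) : EReal)) g :=
    hg.of_abs_sub_le fun x y => EReal.abs_truncate_sub_le k (u x) (u y)
  obtain ⟨v, ⟨K, hv⟩, ⟨h₂, hh₂, hh₂X⟩, hvX⟩ := exists_lipschitz_approx_of_bounded hball hdoubling
    hp hPI hAC hW (u := fun x => EReal.truncate k (u x)) (k := k)
    (fun x => EReal.abs_truncate_le k (u x)) hTm hgT hgX hε4
  have hvm : Measurable v := hv.continuous.measurable
  have hm₁ : AEMeasurable (fun x => (u x - EReal.truncate k (u x)).abs) μ := by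
    refine EReal.measurable_abs.comp_aemeasurable ?_
    exact (measurable_id.sub
      (EReal.measurable_truncate k).coe_real_ereal).comp_aemeasurable hum
  have hm₂ : AEMeasurable (fun x => ENNReal.ofReal |EReal.truncate k (u x) - v x|) μ :=
    (hTm.sub hvm.aemeasurable).abs.ennreal_ofReal
  refine ⟨v, ⟨K, hv⟩, ⟨hvm.coe_real_ereal.aemeasurable, ?_⟩, ?_⟩
  · have hug : IsUpperGradient (fun x => (v x : EReal)) (fun x => g x + h₂ x) := by
      refine hgT.of_abs_sub_le_add hh₂ fun x y => ?_
      rw [EReal.abs_coe_sub_coe, EReal.abs_coe_sub_coe, EReal.abs_coe_sub_coe,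
        ← ENNReal.ofReal_add (abs_nonneg _) (abs_nonneg _)]
      refine ENNReal.ofReal_le_ofReal ?_
      set a := EReal.truncate k (u x)
      set b := EReal.truncate k (u y)
      calc |v x - v y| = |(a - b) - ((a - v x) - (b - v y))| := by ring_nf
        _ ≤ _ := abs_sub _ _
    refine (newtonianNorm_le hug).trans_lt (ENNReal.add_lt_top.2 ⟨?_, ?_⟩)
    · refine lt_of_le_of_lt ((X.mono _ (fun x => (u x).abs +
        ENNReal.ofReal |EReal.truncate k (u x) - v x|) ?_ (huabs.add hm₂)
        (Eventually.of_forall fun x => ?_)).trans (X.add_le _ _ huabs hm₂))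
        (ENNReal.add_lt_top.2 ⟨huX, hvX.trans_le le_top⟩)
      · exact EReal.measurable_abs.comp_aemeasurable hvm.coe_real_ereal.aemeasurable
      · refine le_trans ?_ (add_le_add_left (EReal.abs_truncate_coe_le k (u x)) _)
        rw [EReal.abs_def, EReal.abs_def, ← ENNReal.ofReal_add (abs_nonneg _) (abs_nonneg _)]
        refine ENNReal.ofReal_le_ofReal ?_
        set a := EReal.truncate k (u x)
        calc |v x| = |a - (a - v x)| := by ring_nf
          _ ≤ _ := abs_sub _ _
    · exact (X.add_le _ _ hg.1.aemeasurable hh₂.1.aemeasurable).trans_lt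
        (ENNReal.add_lt_top.2 ⟨hgX, hh₂X.trans_le le_top⟩)
  · have hsplit := fun x => EReal.sub_coe_eq_sub_truncate_add k (u x) (v x)
    have hug : IsUpperGradient (fun x => u x - (v x : EReal)) (fun x => h₁ x + h₂ x) := by
      refine hh₁.of_abs_sub_le_add hh₂ fun x y => ?_
      rw [hsplit x, hsplit y]
      exact EReal.abs_add_coe_sub_le _ _ _ _
    have hX : X (fun x => (u x - (v x : EReal)).abs) <  ε / 4 + ε / 4 := by
      refine lt_of_le_of_lt ((X.mono _ (fun x => (u x - EReal.truncate k (u x)).abs +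
        ENNReal.ofReal |EReal.truncate k (u x) - v x|) ?_ (hm₁.add hm₂)
        (Eventually.of_forall fun x => ?_)).trans (X.add_le _ _ hm₁ hm₂))
        (ENNReal.add_lt_add hk hvX)
      · exact EReal.measurable_abs.comp_aemeasurable (hum.sub hvm.coe_real_ereal.aemeasurable)
      · simp only [hsplit x]
        exact EReal.abs_add_coe_le _ _
    calc newtonianNorm X (fun x => u x - (v x : EReal)) ≤ _ := newtonianNorm_le hug
      _ ≤ X (fun x => (u x - (v x : EReal)).abs) + (X h₁ + X h₂) := by
          gcongr
          exact X.add_le _ _ hh₁.1.aemeasurable hh₂.1.aemeasurable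
      _ < (ε / 4 + ε / 4) + (ε / 4 + ε / 4) :=
          ENNReal.add_lt_add hX (ENNReal.add_lt_add hh₁X hh₂X)
      _ = ε := by
          have : ε / 4 + ε / 4 + (ε / 4 + ε / 4) = 4 * (ε / 4) := by ring
          rw [this, ENNReal.mul_div_cancel (by simp) (by simp)]

end Density

/-! ### Decreasing rearrangements -/

section Rearrangement

variable {α : Type*} [MeasurableSpace α] {μ : Measure α}

/-- The backward direction is right continuity of the distribution function: `{f > s}` is the
increasing union of `{f > r n}` for `r n ↓ s`. -/
theorem lt_rearr_iff {f : α → ℝ≥0∞} {s : ℝ≥0∞} {t : ℝ} :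
    s < rearr μ f t ↔ ENNReal.ofReal t < μ {x | s < f x} := by
  constructor
  · intro h
    by_contra hle
    exact h.not_ge (sInf_le (not_lt.1 hle))
  · intro h
    by_contra hle
    rw [not_lt] at hle
    rcases eq_or_ne s ∞ with rfl | hs
    · simp at h
    obtain ⟨r, hr, hlt, htend⟩ := exists_seq_strictAnti_tendsto' (lt_top_iff_ne_top.2 hs)
    have hU : {x | s < f x} = ⋃ n, {x | r n < f x} := by
      ext x
      simp only [mem_ofPred_eq, mem_iUnion]
      exact ⟨fun hx => (htend.eventually (gt_mem_nhds hx)).exists,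
        fun ⟨n, hn⟩ => (hlt n).1.trans hn⟩
    have hmono : Monotone fun n => {x | r n < f x} := fun m n hmn x (hx : r m < f x) =>
      (hr.antitone hmn).trans_lt hx
    rw [hU, hmono.measure_iUnion] at h
    refine h.not_ge (iSup_le fun n => ?_)
    obtain ⟨a, ha, han⟩ := sInf_lt_iff.1 (hle.trans_lt (hlt n).1)
    exact (measure_mono fun x hx => han.trans hx).trans ha

theorem antitone_rearr (f : α → ℝ≥0∞) : Antitone (rearr μ f) := fun _ _ hst =>
  sInf_le_sInf fun _ ha => le_trans ha (ENNReal.ofReal_le_ofReal hst)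

theorem setOf_lt_indicator_one {α : Type*} (E : Set α) (s : ℝ≥0∞) :
    {x | s < E.indicator 1 x} = if s < 1 then E else ∅ := by
  ext x
  by_cases hx : x ∈ E <;> by_cases hs : s < 1 <;> simp [hx, hs]

theorem rearr_indicator_one (E : Set α) (t : ℝ) :
    rearr μ (E.indicator 1) t = if ENNReal.ofReal t < μ E then 1 else 0 := by
  refine eq_of_forall_lt_iff fun s => ?_
  rw [lt_rearr_iff, setOf_lt_indicator_one]
  by_cases hs : s < 1 <;> by_cases ht : ENNReal.ofReal t < μ E <;> simp [hs, ht]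

/-- Both distributions are finite with the same total mass and agree on every ray `Ioi s`: there `{f
> s} ⊆ E`, and `{f^* > s}` meets `(0, μ E)` in the interval `(0, μ {f > s})`. -/
theorem map_rearr_eq {E : Set α} (hE : NullMeasurableSet E μ) (hfin : μ E < ∞) {f : α → ℝ≥0∞}
    (hf : AEMeasurable f μ) (h0 : ∀ x ∉ E, f x = 0) :
    (μ.restrict E).map f = (volume.restrict (Ioo 0 (μ E).toReal)).map (rearr μ f) := by
  have hfE : AEMeasurable f (μ.restrict E) := hf.restrict
  have hr : Measurable (rearr μ f) := (antitone_rearr f).measurable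
  have hfin1 : IsFiniteMeasure (μ.restrict E) := ⟨by simpa using hfin⟩
  have : IsFiniteMeasure ((μ.restrict E).map f) := Measure.isFiniteMeasure_map _ _
  have : IsFiniteMeasure ((volume.restrict (Ioo 0 (μ E).toReal)).map (rearr μ f)) :=
    Measure.isFiniteMeasure_map _ _
  have huniv : (μ.restrict E).map f univ =
      (volume.restrict (Ioo 0 (μ E).toReal)).map (rearr μ f) univ := by
    rw [Measure.map_apply_of_aemeasurable hfE MeasurableSet.univ,
      Measure.map_apply hr MeasurableSet.univ]
    simp [hfin.ne]
  have hIoi : ∀ s, (μ.restrict E).map f (Ioi s) =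
      (volume.restrict (Ioo 0 (μ E).toReal)).map (rearr μ f) (Ioi s) := by
    intro s
    rw [Measure.map_apply_of_aemeasurable hfE measurableSet_Ioi,
      Measure.map_apply hr measurableSet_Ioi, Measure.restrict_apply₀'  hE,
      Measure.restrict_apply (hr measurableSet_Ioi)]
    have hsub : f ⁻¹' Ioi s ⊆ E := by
      intro x hx
      by_contra hxE
      have hx : s < f x := hx
      rw [h0 x hxE] at hx
      exact not_lt_zero hx
    rw [inter_eq_self_of_subset_left hsub]
    have hle : μ (f ⁻¹' Ioi s) ≤ μ E := measure_mono hsub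
    have hset : rearr μ f ⁻¹' Ioi s ∩ Ioo 0 (μ E).toReal = Ioo 0 (μ (f ⁻¹' Ioi s)).toReal := by
      ext t
      simp only [mem_inter_iff, mem_preimage, mem_Ioi, mem_Ioo, lt_rearr_iff]
      have hiff : 0 < t → (ENNReal.ofReal t < μ {x | s < f x} ↔ t < (μ (f ⁻¹' Ioi s)).toReal) :=
        fun ht => ENNReal.ofReal_lt_iff_lt_toReal ht.le (hle.trans_lt hfin).ne
      constructor
      · rintro ⟨h1, h2, -⟩
        exact ⟨h2, (hiff h2).1 h1⟩
      · rintro ⟨h1, h2⟩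
        exact ⟨(hiff h1).2 h2, h1, h2.trans_le (ENNReal.toReal_mono hfin.ne hle)⟩
    rw [hset, Real.volume_Ioo, sub_zero, ENNReal.ofReal_toReal (hle.trans_lt hfin).ne]
  refine Measure.ext_of_Iic _ _ fun s => ?_
  rw [← compl_Ioi, measure_compl measurableSet_Ioi (measure_ne_top _ _),
    measure_compl measurableSet_Ioi (measure_ne_top _ _), huniv, hIoi]

theorem lintegral_rpow_eq_rearr {p : ℝ} (hp : 0 < p) {E : Set α} (hE : NullMeasurableSet E μ)
    (hfin : μ E < ∞) {f : α → ℝ≥0∞} (hf : AEMeasurable f μ) (h0 : ∀ x ∉ E, f x = 0) :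
    ∫⁻ x, f x ^ p ∂μ = ∫⁻ t in Ioo 0 (μ E).toReal, rearr μ f t ^ p := by
  have h1 : ∫⁻ x, f x ^ p ∂μ = ∫⁻ x in E, f x ^ p ∂μ := by
    rw [← lintegral_indicator₀ hE]
    refine lintegral_congr fun x => ?_
    by_cases hx : x ∈ E
    · rw [indicator_of_mem hx]
    · rw [indicator_of_notMem hx, h0 x hx, ENNReal.zero_rpow_of_pos hp]
  have hm : Measurable fun y : ℝ≥0∞ => y ^ p := by fun_prop
  rw [h1, ← lintegral_map' hm.aemeasurable hf.restrict, map_rearr_eq hE hfin hf h0,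
    lintegral_map hm (antitone_rearr f).measurable]

end Rearrangement

theorem ENNReal.eq_of_forall_ofReal_lt_iff {a b : ℝ≥0∞}
    (h : ∀ t : ℝ, 0 < t → (ENNReal.ofReal t < a ↔ ENNReal.ofReal t < b)) : a = b := by
  have key : ∀ {a b : ℝ≥0∞}, (∀ t : ℝ, 0 < t → (ENNReal.ofReal t < a → ENNReal.ofReal t < b)) →
      a ≤ b := by
    intro a b h
    refine le_of_forall_lt fun c hc => ?_
    obtain ⟨d, hcd, hda⟩ := exists_between hc
    have hd : d ≠ ∞ := ne_top_of_lt hda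
    have := h d.toReal (ENNReal.toReal_pos (pos_of_gt hcd).ne' hd)
      (by rwa [ENNReal.ofReal_toReal hd])
    rw [ENNReal.ofReal_toReal hd] at this
    exact hcd.trans this
  exact le_antisymm (key fun t ht => (h t ht).1) (key fun t ht => (h t ht).2)

/-! ### The fundamental function -/

/-- A measure is divisible if every set has subsets of all smaller measures. -/
def IsDivisible {α : Type*} [MeasurableSpace α] (μ : Measure α) : Prop :=
  ∀ ⦃G : Set α⦄, NullMeasurableSet G μ → ∀ s ≤ μ G, ∃ F ⊆ G, NullMeasurableSet F μ ∧ μ F = s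

namespace RISpace

variable {α : Type*} [MeasurableSpace α] {μ : Measure α} (X : RISpace μ)

theorem fundamental_eq {E : Set α} (hE : NullMeasurableSet E μ) {t : ℝ}
    (ht : μ E = min (ENNReal.ofReal t) (μ univ)) : X.fundamental t = X (E.indicator 1) := by
  unfold fundamental
  split_ifs with h
  · rw [min_eq_left h.le] at ht
    refine le_antisymm (iSup_le fun F => iSup_le fun hF => iSup_le fun hFt => ?_) ?_
    · exact (X.indicator_one_congr hF hE (hFt.trans ht.symm)).le
    · exact le_iSup_of_le E (le_iSup_of_le hE (le_iSup_of_le ht le_rfl))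
  · rw [min_eq_right (not_lt.1 h)] at ht
    rw [X.indicator_one_congr hE nullMeasurableSet_univ ht, indicator_univ]

theorem fundamental_toReal_measure {E : Set α} (hE : NullMeasurableSet E μ) (hfin : μ E < ∞) :
    X.fundamental (μ E).toReal = X (E.indicator 1) :=
  X.fundamental_eq hE (by
    rw [ENNReal.ofReal_toReal hfin.ne, min_eq_left (measure_mono (subset_univ E))])

variable {X}

theorem exists_fundamental_eq (hna : IsDivisible μ) (t : ℝ) : ∃ E, NullMeasurableSet E μ ∧
    μ E = min (ENNReal.ofReal t) (μ univ) ∧ X.fundamental t = X (E.indicator 1) := by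
  obtain ⟨E, -, hE, hEt⟩ := hna nullMeasurableSet_univ (min (ENNReal.ofReal t) (μ univ))
    (min_le_right _ _)
  exact ⟨E, hE, hEt, X.fundamental_eq hE hEt⟩

theorem fundamental_lt_top (hna : IsDivisible μ) (t : ℝ) : X.fundamental t < ∞ := by
  obtain ⟨E, hE, hEt, h⟩ := exists_fundamental_eq (X := X) hna t
  rw [h]
  exact X.indicator_lt_top E hE (hEt ▸ (min_le_left _ _).trans_lt ENNReal.ofReal_lt_top)

theorem fundamental_pos (hna : IsDivisible μ) (hμ : μ univ ≠ 0) {t : ℝ} (ht : 0 < t) :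
    0 < X.fundamental t := by
  obtain ⟨E, hE, hEt, h⟩ := exists_fundamental_eq (X := X) hna t
  rw [h]
  refine X.indicator_one_pos hE ?_
  rw [hEt]
  exact (lt_min (ENNReal.ofReal_pos.2 ht) (pos_iff_ne_zero.2 hμ)).ne'

theorem indicator_one_mono (hna : IsDivisible μ) {E F : Set α} (hE : NullMeasurableSet E μ)
    (hF : NullMeasurableSet F μ) (h : μ E ≤ μ F) : X (E.indicator 1) ≤ X (F.indicator 1) := by
  obtain ⟨G, hGF, hG, hGE⟩ := hna hF _ h
  rw [X.indicator_one_congr hE hG hGE.symm]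
  exact X.mono _ _ (aemeasurable_one.indicator₀ hG) (aemeasurable_one.indicator₀ hF)
    (Eventually.of_forall (indicator_le_indicator_of_subset hGF fun _ => zero_le))

theorem monotone_fundamental (hna : IsDivisible μ) : Monotone X.fundamental := by
  intro s t hst
  obtain ⟨E, hE, hEs, h1⟩ := exists_fundamental_eq (X := X) hna s
  obtain ⟨F, hF, hFt, h2⟩ := exists_fundamental_eq (X := X) hna t
  rw [h1, h2]
  refine indicator_one_mono hna hE hF ?_
  rw [hEs, hFt]
  exact min_le_min (ENNReal.ofReal_le_ofReal hst) le_rfl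

/-- For `r < f^*(t)` the set `{f > r}` has measure above `t`, so `r * φ(t) ≤ r * ‖χ_{f > r}‖ ≤ ‖f‖`.
-/
theorem rearr_mul_fundamental_le (hna : IsDivisible μ) {f : α → ℝ≥0∞}
    (hf : AEMeasurable f μ) (t : ℝ) :
    rearr μ f t * X.fundamental t ≤ X f := by
  obtain ⟨E, hE, hEt, h⟩ := exists_fundamental_eq (X := X) hna t
  rw [h]
  refine ENNReal.le_of_forall_nnreal_lt fun c hc => ?_
  have hX : X (E.indicator 1) < ∞ :=
    X.indicator_lt_top E hE (hEt ▸ (min_le_left _ _).trans_lt ENNReal.ofReal_lt_top)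
  rcases eq_or_ne (X (E.indicator 1)) 0 with h0 | h0
  · rw [h0, mul_zero] at hc; exact absurd hc not_lt_zero
  have hlt : (c : ℝ≥0∞) / X (E.indicator 1) < rearr μ f t :=
    ENNReal.div_lt_of_lt_mul hc
  obtain ⟨r, hr⟩ : ∃ r : ℝ≥0, (r : ℝ≥0∞) = c / X (E.indicator 1) :=
    ⟨_, ENNReal.coe_toNNReal (ne_top_of_lt hlt)⟩
  rw [← hr] at hlt
  have hm : NullMeasurableSet {x | (r : ℝ≥0∞) < f x} μ := hf.nullMeasurable measurableSet_Ioi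
  calc (c : ℝ≥0∞) = r * X (E.indicator 1) := by rw [hr, ENNReal.div_mul_cancel h0 hX.ne]
    _ ≤ r * X ({x | (r : ℝ≥0∞) < f x}.indicator 1) := by
        gcongr
        refine indicator_one_mono hna hE hm ?_
        rw [hEt]
        exact (min_le_left _ _).trans (lt_rearr_iff.1 hlt).le
    _ ≤ X f := X.coe_mul_indicator_one_le hm hf fun x hx => le_of_lt hx

/-- All admissible `u` share their rearrangement at positive `t`, which already determines every `μ
{u > s}`. They are thus equimeasurable, and the infimum runs over a constant. -/
theorem reprNorm_eq {f : RPos → ℝ≥0∞} {u : α → ℝ≥0∞} (hu : AEMeasurable u μ)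
    (h : ∀ t : RPos, rearr μ u t =
      if ENNReal.ofReal t < μ univ then rearr volRPos f t else 0) : X.reprNorm f = X u := by
  refine le_antisymm (iInf_le_of_le u (iInf_le_of_le hu (iInf_le _ h)))
    (le_iInf fun v => le_iInf fun hv => le_iInf fun hvf => ?_)
  refine (X.rearrangement_invariant u v hu hv fun s => ?_).le
  refine ENNReal.eq_of_forall_ofReal_lt_iff fun t ht => ?_
  rw [← lt_rearr_iff, ← lt_rearr_iff, h ⟨t, ht⟩, hvf ⟨t, ht⟩]

theorem _root_.measurableEmbedding_RPos_val : MeasurableEmbedding (Subtype.val : RPos → ℝ) :=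
  MeasurableEmbedding.subtype_coe (s := {t : ℝ | 0 < t}) measurableSet_Ioi

theorem volRPos_Iio (t : ℝ) : volRPos {x : RPos | (x : ℝ) < t} = ENNReal.ofReal t := by
  have h : Subtype.val '' {x : RPos | (x : ℝ) < t} = Ioo 0 t := by
    ext x
    simp [and_comm]
  rw [volRPos, measurableEmbedding_RPos_val.comap_apply, h, Real.volume_Ioo, sub_zero]

theorem reprNorm_indicator (hna : IsDivisible μ) (t : ℝ) :
    X.reprNorm ({x : RPos | (x : ℝ) < t}.indicator 1) = X.fundamental t := by
  obtain ⟨E, hE, hEt, h⟩ := exists_fundamental_eq (X := X) hna t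
  rw [h]
  refine reprNorm_eq (aemeasurable_one.indicator₀ hE) fun s => ?_
  rw [rearr_indicator_one, rearr_indicator_one, volRPos_Iio, hEt]
  simp only [lt_min_iff]
  by_cases h1 : ENNReal.ofReal s < ENNReal.ofReal t <;>
    by_cases h2 : ENNReal.ofReal s < μ univ <;> simp only [h1, h2] <;> simp

/-- The dilation `E_{1/s}` carries `χ_(0, t)` to `χ_(0, st)`, so this quotient is one of those in
the supremum. -/
theorem fundamental_div_le_dilationNorm (hna : IsDivisible μ) (hμ : μ univ ≠ 0) (s : RPos)
    {t : ℝ} (ht : 0 < t) :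
    X.fundamental (s * t) / X.fundamental t ≤ X.dilationNorm s := by
  have hd : dilation s⁻¹ ({x : RPos | (x : ℝ) < t}.indicator 1) =
      {x : RPos | (x : ℝ) < s * t}.indicator 1 := by
    ext x
    have hiff : (((s⁻¹ * x : RPos) : ℝ) < t) ↔ (x : ℝ) < s * t := by
      have : ((s⁻¹ * x : RPos) : ℝ) = (s : ℝ)⁻¹ * x := rfl
      rw [this, inv_mul_lt_iff₀ s.2]
    by_cases hx : (x : ℝ) < s * t
    · rw [dilation, indicator_of_mem (show s⁻¹ * x ∈ {x : RPos | (x : ℝ) < t} from hiff.2 hx),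
        indicator_of_mem (show x ∈ {x : RPos | (x : ℝ) < s * t} from hx)]
      rfl
    · rw [dilation, indicator_of_notMem (show s⁻¹ * x ∉ {x : RPos | (x : ℝ) < t} from
        fun h => hx (hiff.1 h)),
        indicator_of_notMem (show x ∉ {x : RPos | (x : ℝ) < s * t} from hx)]
  have hm : MeasurableSet {x : RPos | (x : ℝ) < t} :=
    measurable_subtype_coe measurableSet_Iio
  have h1 := reprNorm_indicator (X := X) hna t
  have h2 := reprNorm_indicator (X := X) hna (s * t)
  rw [← h2, ← h1, ← hd]
  refine le_iSup_of_le ({x : RPos | (x : ℝ) < t}.indicator 1) (le_iSup_of_le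
    (measurable_one.indicator hm).aemeasurable (le_iSup_of_le ?_ (le_iSup_of_le ?_ le_rfl)))
  · rw [h1]; exact (fundamental_pos hna hμ ht).ne'
  · rw [h1]; exact fundamental_lt_top hna t

end RISpace

/-! ### Sufficient conditions for the control of `L^p` means -/

theorem lintegral_Ioo_rpow {r : ℝ} (hr : -1 < r) {T : ℝ} (hT : 0 ≤ T) :
    ∫⁻ s in Ioo 0 T, ENNReal.ofReal s ^ r = ENNReal.ofReal (T ^ (r + 1) / (r + 1)) := by
  have hr1 : r + 1 ≠ 0 := by linarith
  have hint : IntegrableOn (fun s : ℝ => s ^ r) (Ioo 0 T) :=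
    (intervalIntegrable_iff_integrableOn_Ioo_of_le hT).1
      (intervalIntegral.intervalIntegrable_rpow' hr)
  have hval : ∫ s in Ioo 0 T, s ^ r = T ^ (r + 1) / (r + 1) := by
    rw [← integral_Ioc_eq_integral_Ioo, ← intervalIntegral.integral_of_le hT,
      integral_rpow (Or.inl hr), Real.zero_rpow hr1, sub_zero]
  rw [← hval, ofReal_integral_eq_lintegral_ofReal hint
    ((ae_restrict_mem measurableSet_Ioo).mono fun s hs => Real.rpow_nonneg hs.1.le r)]
  exact setLIntegral_congr_fun measurableSet_Ioo fun s hs => ENNReal.ofReal_rpow_of_pos hs.1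

section Conditions

variable {α : Type*} [MeasurableSpace α] {μ : Measure α} {X : RISpace μ} {p : ℝ}

/-- The constants of an embedding on sets of finite measure are uniform on small sets. -/
theorem EmbedsFm.exists_uniform {A B : (α → ℝ≥0∞) → ℝ≥0∞} (h : EmbedsFm μ A B) :
    ∃ (c : ℝ≥0) (δ : ℝ≥0∞), 0 < δ ∧ ∀ (E : Set α) (f : α → ℝ≥0∞), NullMeasurableSet E μ →
      μ E < δ → AEMeasurable f μ → (∀ x ∉ E, f x = 0) → A f < ∞ → B f ≤ c * A f := by
  -- Violations with constants `n` on sets of measure below `2⁻¹ ^ n` all live on one set of finite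
  -- measure, where a single constant works.
  by_contra! hcon
  have hpos : ∀ n : ℕ, (0 : ℝ≥0∞) < 2⁻¹ ^ n := fun n => ENNReal.pow_pos (by simp) n
  choose E f hEm hE hf h0 hA hB using fun n : ℕ => hcon n (2⁻¹ ^ n) (hpos n)
  have hfin : μ (⋃ n, E n) < ∞ := by
    calc μ (⋃ n, E n) ≤ ∑' n, μ (E n) := measure_iUnion_le _
      _ ≤ ∑' n : ℕ, 2⁻¹ ^ n := ENNReal.tsum_le_tsum fun n => (hE n).le
      _ = 2 := by rw [ENNReal.tsum_geometric, ENNReal.one_sub_inv_two, inv_inv]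
      _ < ∞ := by simp
  obtain ⟨c, hc⟩ := h _ (NullMeasurableSet.iUnion hEm) hfin
  obtain ⟨n, hn⟩ := exists_nat_ge c
  have h1 := hc (f n) (hf n) (hA n)
  have h2 : (⋃ n, E n).indicator (f n) = f n :=
    indicator_eq_self.2 fun x hx => mem_iUnion.2 ⟨n, by
      by_contra hxE
      exact hx (h0 n x hxE)⟩
  rw [h2] at h1
  refine (hB n).not_ge (h1.trans ?_)
  gcongr

/-- In `(0, ∞)` the ball of centre and radius `t` is `(0, 2t)`; it contains both `t` and `(0, t)`.
-/
theorem lintegral_Ioo_le_maximalOp (hp : 0 < p) (f : ℝ → ℝ≥0∞) (t : RPos) :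
    (∫⁻ s in Ioo 0 (t : ℝ), f s ^ p) ^ (1 / p) ≤
      ENNReal.ofReal (2 * t) ^ (1 / p) * maximalOp volRPos p (fun s => f s) t := by
  have ht : 0 < (t : ℝ) := t.2
  have hball : Metric.ball t (t : ℝ) = {x : RPos | (x : ℝ) < 2 * t} := by
    ext x
    have hx : 0 < (x : ℝ) := x.2
    rw [Metric.mem_ball, Subtype.dist_eq, Real.dist_eq, abs_lt, mem_ofPred_eq]
    constructor
    · rintro ⟨-, h⟩; linarith
    · intro h; constructor <;> linarith
  have hle : ∫⁻ s in Ioo 0 (t : ℝ), f s ^ p ≤ ∫⁻ y in Metric.ball t (t : ℝ), f y ^ p ∂volRPos := by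
    have he := measurableEmbedding_RPos_val
    have hpre : Metric.ball t (t : ℝ) = Subtype.val ⁻¹' (Iio (2 * (t : ℝ))) := hball
    rw [hpre, volRPos, ← he.lintegral_map (fun s => f s ^ p), ← he.restrict_map, he.map_comap,
      Measure.restrict_restrict measurableSet_Iio]
    refine lintegral_mono_set fun s hs => ⟨?_, ?_⟩
    · rw [mem_Iio]; linarith [hs.2]
    · exact ⟨⟨s, hs.1⟩, rfl⟩
  have hmax : (⨍⁻ y in Metric.ball t (t : ℝ), f y ^ p ∂volRPos) ^ (1 / p) ≤
      maximalOp volRPos p (fun s => f s) t :=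
    le_iSup_of_le t (le_iSup_of_le (t : ℝ) (le_iSup_of_le (Metric.mem_ball_self ht) le_rfl))
  rw [setLAverage_eq, hball, RISpace.volRPos_Iio, ← hball] at hmax
  refine le_trans ?_ (mul_le_mul_right hmax _)
  have h2t : ENNReal.ofReal (2 * t) ≠ 0 := by
    rw [Ne, ENNReal.ofReal_eq_zero]; linarith
  rw [← ENNReal.mul_rpow_of_nonneg _ _ (by positivity),
    ENNReal.mul_div_cancel h2t ENNReal.ofReal_ne_top]
  exact ENNReal.rpow_le_rpow hle (by positivity)

namespace RISpace

theorem controlsLpMean_of_marcinkiewicz (hp : 1 ≤ p)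
    (h : Embeds μ X (marcinkiewiczLocNorm μ p X.fundamental)) : X.ControlsLpMean p := by
  obtain ⟨c, hc⟩ := h
  have hp0 : 0 < p := by linarith
  refine ⟨2 * c, 1, one_pos, fun E f hE hpos hlt hf h0 hX => ?_⟩
  have hfin : μ E < ∞ := hlt.trans ENNReal.one_lt_top
  set t : RPos := ⟨(μ E).toReal, ENNReal.toReal_pos hpos.ne' hfin.ne⟩ with ht
  have ht1 : (t : ℝ) < 1 := by
    have := (ENNReal.toReal_lt_toReal hfin.ne ENNReal.one_ne_top).2 hlt
    simpa using this
  have hmarc : maximalOp volRPos p (fun s => rearr μ f s) t * X (E.indicator 1) ≤ c * X f := by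
    rw [← X.fundamental_toReal_measure hE hfin]
    refine le_trans ?_ (hc f hf hX)
    exact le_iSup_of_le t (le_iSup_of_le ht1 le_rfl)
  rw [lintegral_rpow_eq_rearr hp0 hE hfin hf h0]
  calc X (E.indicator 1) * (∫⁻ s in Ioo 0 (t : ℝ), rearr μ f s ^ p) ^ (1 / p)
      ≤ X (E.indicator 1) * (ENNReal.ofReal (2 * t) ^ (1 / p) *
          maximalOp volRPos p (fun s => rearr μ f s) t) := by
        gcongr
        exact lintegral_Ioo_le_maximalOp hp0 _ t
    _ = ENNReal.ofReal (2 * t) ^ (1 / p) *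
          (maximalOp volRPos p (fun s => rearr μ f s) t * X (E.indicator 1)) := by ring
    _ ≤ (2 * μ E ^ (1 / p)) * (c * X f) := by
        gcongr
        rw [ENNReal.ofReal_mul (by norm_num), ENNReal.mul_rpow_of_nonneg _ _ (by positivity),
          ENNReal.ofReal_toReal hfin.ne, ENNReal.ofReal_ofNat]
        gcongr
        calc (2 : ℝ≥0∞) ^ (1 / p) ≤ 2 ^ (1 : ℝ) :=
              ENNReal.rpow_le_rpow_of_exponent_le (by norm_num)
                (by rw [div_le_one hp0]; exact hp)
          _ = 2 := ENNReal.rpow_one _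
    _ = _ := by push_cast; ring

/-- For `s < t = μ E < 1` the majorant satisfies `ψ(s) ≥ s^{1/p} φ(t) t^{-1/p}`, so the `p`-th power
of the Lorentz norm is at least `φ(t)^p / t * ∫ f ^ p`. -/
theorem controlsLpMean_of_lambda (hp : 1 ≤ p)
    (h : EmbedsFm μ X (lambdaNorm μ p (quasiconcaveMajorant p X.fundamental))) :
    X.ControlsLpMean p := by
  obtain ⟨c, δ, hδ, hc⟩ := h.exists_uniform
  have hp0 : 0 < p := by linarith
  refine ⟨c, min δ 1, lt_min hδ one_pos, fun E f hE hpos hlt hf h0 hX => ?_⟩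
  have hlt1 : μ E < 1 := hlt.trans_le (min_le_right _ _)
  have hfin : μ E < ∞ := hlt1.trans ENNReal.one_lt_top
  set t : ℝ := (μ E).toReal with ht
  have ht0 : 0 < t := ENNReal.toReal_pos hpos.ne' hfin.ne
  have ht1 : t < 1 := by
    have := (ENNReal.toReal_lt_toReal hfin.ne ENNReal.one_ne_top).2 hlt1
    simpa using this
  have hofReal : ENNReal.ofReal t = μ E := ENNReal.ofReal_toReal hfin.ne
  have key : X (E.indicator 1) ^ p / μ E * ∫⁻ x, f x ^ p ∂μ ≤
      ∫⁻ s in Ioi (0 : ℝ), (rearr μ f s * quasiconcaveMajorant p X.fundamental s) ^ p /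
        ENNReal.ofReal s := by
    rw [lintegral_rpow_eq_rearr hp0 hE hfin hf h0, ← lintegral_const_mul _
      (by have := (antitone_rearr (μ := μ) f).measurable; fun_prop)]
    refine le_trans (setLIntegral_mono' measurableSet_Ioo fun s hs => ?_)
      (lintegral_mono_set (fun s hs => hs.1 : Ioo 0 t ⊆ Ioi 0))
    have hs0 : ENNReal.ofReal s ≠ 0 := (ENNReal.ofReal_pos.2 hs.1).ne'
    have hmaj : ENNReal.ofReal s ^ (1 / p) * (X (E.indicator 1) / μ E ^ (1 / p)) ≤
        quasiconcaveMajorant p X.fundamental s := by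
      unfold quasiconcaveMajorant
      rw [if_neg (not_le.2 hs.1), if_pos (hs.2.trans ht1).le]
      gcongr
      refine le_iSup₂_of_le t ⟨hs.2.le, ht1.le⟩ ?_
      rw [hofReal, X.fundamental_toReal_measure hE hfin]
    calc X (E.indicator 1) ^ p / μ E * rearr μ f s ^ p
        = (rearr μ f s * (ENNReal.ofReal s ^ (1 / p) * (X (E.indicator 1) / μ E ^ (1 / p)))) ^ p /
            ENNReal.ofReal s := by
          rw [ENNReal.mul_rpow_of_nonneg _ _ hp0.le, ENNReal.mul_rpow_of_nonneg _ _ hp0.le,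
            ENNReal.div_rpow_of_nonneg _ _ hp0.le, ← ENNReal.rpow_mul, ← ENNReal.rpow_mul,
            one_div_mul_cancel hp0.ne', ENNReal.rpow_one, ENNReal.rpow_one, mul_div_assoc,
            mul_comm (ENNReal.ofReal s), ENNReal.mul_div_cancel_right hs0 ENNReal.ofReal_ne_top,
            mul_comm]
      _ ≤ _ := by gcongr
  have h1 := hc E f hE (hlt.trans_le (min_le_left _ _)) hf h0 hX
  have h2 := ENNReal.rpow_le_rpow key (show 0 ≤ 1 / p by positivity)
  have h3 := h2.trans h1
  rw [ENNReal.mul_rpow_of_nonneg _ _ (by positivity),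
    ENNReal.div_rpow_of_nonneg _ _ (by positivity),
    ← ENNReal.rpow_mul, mul_one_div_cancel hp0.ne', ENNReal.rpow_one] at h3
  have hR : μ E ^ (1 / p) ≠ 0 := by simp [hpos.ne', hfin.ne]
  have hR' : μ E ^ (1 / p) ≠ ∞ := ENNReal.rpow_ne_top_of_nonneg (by positivity) hfin.ne
  calc X (E.indicator 1) * (∫⁻ x, f x ^ p ∂μ) ^ (1 / p)
      = μ E ^ (1 / p) * (X (E.indicator 1) / μ E ^ (1 / p) * (∫⁻ x, f x ^ p ∂μ) ^ (1 / p)) := by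
        rw [← mul_assoc, ENNReal.mul_div_cancel hR hR']
    _ ≤ μ E ^ (1 / p) * (c * X f) := by gcongr
    _ = _ := by ring

theorem _root_.lorentzNorm_indicator_one_le (hp : 1 ≤ p) {E : Set α} (hfin : μ E < ∞) :
    lorentzNorm μ p 1 (E.indicator 1) ≤ μ E ^ (1 / p) := by
  have hp0 : 0 < p := by linarith
  have hp1 : 0 < 1 / p := by positivity
  unfold lorentzNorm
  rw [div_one, ENNReal.rpow_one]
  calc ENNReal.ofReal (1 / p) * ∫⁻ t in Ioi (0 : ℝ),
        (rearr μ (E.indicator 1) t * ENNReal.ofReal t ^ (1 / p)) ^ (1 : ℝ) / ENNReal.ofReal t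
      ≤ ENNReal.ofReal (1 / p) * ∫⁻ t in Ioo 0 (μ E).toReal, ENNReal.ofReal t ^ (1 / p - 1) := by
        refine mul_le_mul_right ?_ _
        rw [← lintegral_indicator measurableSet_Ioi, ← lintegral_indicator measurableSet_Ioo]
        refine lintegral_mono fun t => ?_
        by_cases ht : t ∈ Ioi (0 : ℝ)
        · rw [indicator_of_mem ht, rearr_indicator_one, ENNReal.rpow_one]
          split_ifs with hlt
          · rw [indicator_of_mem (show t ∈ Ioo 0 (μ E).toReal from
              ⟨ht, (ENNReal.ofReal_lt_iff_lt_toReal (le_of_lt ht) hfin.ne).1 hlt⟩), one_mul,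
              ENNReal.rpow_sub _ _ (ENNReal.ofReal_pos.2 ht).ne' ENNReal.ofReal_ne_top,
              ENNReal.rpow_one]
          · simp
        · rw [indicator_of_notMem ht]; exact zero_le
    _ = ENNReal.ofReal (1 / p) * ENNReal.ofReal ((μ E).toReal ^ (1 / p) / (1 / p)) := by
        rw [lintegral_Ioo_rpow (by linarith) ENNReal.toReal_nonneg, sub_add_cancel]
    _ = ENNReal.ofReal ((μ E).toReal ^ (1 / p)) := by
        rw [← ENNReal.ofReal_mul hp1.le, mul_div_cancel₀ _ hp1.ne']
    _ = μ E ^ (1 / p) := by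
        rw [← ENNReal.ofReal_rpow_of_nonneg ENNReal.toReal_nonneg hp1.le,
          ENNReal.ofReal_toReal hfin.ne]

/-- The first embedding, tested on `χ_E`, gives `φ(μ E) ≤ c₁ * μ E ^ (1 / p)`; the second bounds the
`L^p` norm of `f`. The product is the claim. -/
theorem controlsLpMean_of_lorentz (hp : 1 ≤ p) (h₁ : EmbedsFm μ (lorentzNorm μ p 1) X)
    (h₂ : EmbedsFm μ X (fun f => eLpNorm f (ENNReal.ofReal p) μ)) : X.ControlsLpMean p := by
  obtain ⟨c₁, δ₁, hδ₁, hc₁⟩ := h₁.exists_uniform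
  obtain ⟨c₂, δ₂, hδ₂, hc₂⟩ := h₂.exists_uniform
  have hp0 : 0 < p := by linarith
  refine ⟨c₁ * c₂, min (min δ₁ δ₂) 1, lt_min (lt_min hδ₁ hδ₂) one_pos,
    fun E f hE hpos hlt hf h0 hX => ?_⟩
  have hfin : μ E < ∞ := (hlt.trans_le (min_le_right _ _)).trans ENNReal.one_lt_top
  have hlt' := hlt.trans_le (min_le_left _ _)
  have hle := lorentzNorm_indicator_one_le hp hfin
  have e1 := hc₁ E (E.indicator 1) hE (hlt'.trans_le (min_le_left _ _))
    (aemeasurable_one.indicator₀ hE) (fun x hx => indicator_of_notMem hx _)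
    (hle.trans_lt (ENNReal.rpow_lt_top_of_nonneg (by positivity) hfin.ne))
  have e2 := hc₂ E f hE (hlt'.trans_le (min_le_right _ _)) hf h0 hX
  rw [eLpNorm_eq_lintegral_rpow_enorm_toReal (by simpa using hp0) ENNReal.ofReal_ne_top,
    ENNReal.toReal_ofReal hp0.le] at e2
  simp only [enorm_eq_self] at e2
  calc X (E.indicator 1) * (∫⁻ x, f x ^ p ∂μ) ^ (1 / p)
      ≤ (c₁ * μ E ^ (1 / p)) * (c₂ * X f) :=
        mul_le_mul' (e1.trans (by gcongr)) e2
    _ = _ := by push_cast; ring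

/-! ### Conditions on the fundamental function and the indices -/

/-- The averages of `φ^{-p}` over `(0, t)` are controlled by `φ(t)^{-p}` for small `t`. -/
def FundamentalAverageBound (X : RISpace μ) (p : ℝ) : Prop :=
  ∃ δ : ℝ, 0 < δ ∧ ∃ C : ℝ≥0, ∀ t ∈ Ioo 0 δ,
    X.fundamental t ^ p * (⨍⁻ s in Ioo 0 t, X.fundamental s ^ (-p) ∂volume) ≤ C

/-- Integrating `f^*(s) ^ p ≤ ‖f‖ ^ p * φ(s) ^ (-p)` over `(0, μ E)`. -/
theorem FundamentalAverageBound.controlsLpMean (hna : IsDivisible μ) (hp : 1 ≤ p)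
    (h : X.FundamentalAverageBound p) : X.ControlsLpMean p := by
  obtain ⟨δ, hδ, C, hC⟩ := h
  have hp0 : 0 < p := by linarith
  have hCp : ((C ^ (1 / p) : ℝ≥0) : ℝ≥0∞) = (C : ℝ≥0∞) ^ (1 / p) :=
    ENNReal.coe_rpow_of_nonneg _ (by positivity)
  refine ⟨C ^ (1 / p), ENNReal.ofReal δ, ENNReal.ofReal_pos.2 hδ,
    fun E f hE hpos hlt hf h0 hX => ?_⟩
  have hfin : μ E < ∞ := hlt.trans ENNReal.ofReal_lt_top
  have hμ : μ univ ≠ 0 := (hpos.trans_le (measure_mono (subset_univ E))).ne'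
  set t : ℝ := (μ E).toReal with ht
  have ht0 : 0 < t := ENNReal.toReal_pos hpos.ne' hfin.ne
  have hofReal : ENNReal.ofReal t = μ E := ENNReal.ofReal_toReal hfin.ne
  have htδ : t < δ := by rwa [← hofReal, ENNReal.ofReal_lt_ofReal_iff hδ] at hlt
  have h1 := hC t ⟨ht0, htδ⟩
  rw [setLAverage_eq, Real.volume_Ioo, sub_zero, hofReal,
    X.fundamental_toReal_measure hE hfin, ← mul_div_assoc,
    ENNReal.div_le_iff hpos.ne' hfin.ne] at h1
  have h2 : ∫⁻ x, f x ^ p ∂μ ≤ X f ^ p * ∫⁻ s in Ioo 0 t, X.fundamental s ^ (-p) := by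
    rw [lintegral_rpow_eq_rearr hp0 hE hfin hf h0, ← lintegral_const_mul _
      (by have := (monotone_fundamental (X := X) hna).measurable; fun_prop)]
    refine setLIntegral_mono' measurableSet_Ioo fun s hs => ?_
    have hφ0 := (fundamental_pos (X := X) hna hμ hs.1).ne'
    have hφ1 := (fundamental_lt_top (X := X) hna s).ne
    rw [ENNReal.rpow_neg, ← div_eq_mul_inv, ← ENNReal.div_rpow_of_nonneg _ _ hp0.le]
    refine ENNReal.rpow_le_rpow ?_ hp0.le
    rw [ENNReal.le_div_iff_mul_le (Or.inl hφ0) (Or.inl hφ1)]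
    exact rearr_mul_fundamental_le hna hf s
  have h3 : X (E.indicator 1) ^ p * ∫⁻ x, f x ^ p ∂μ ≤ C * μ E * X f ^ p := by
    calc X (E.indicator 1) ^ p * ∫⁻ x, f x ^ p ∂μ
        ≤ X (E.indicator 1) ^ p * (X f ^ p * ∫⁻ s in Ioo 0 t, X.fundamental s ^ (-p)) := by gcongr
      _ = X (E.indicator 1) ^ p * (∫⁻ s in Ioo 0 t, X.fundamental s ^ (-p)) * X f ^ p := by ring
      _ ≤ _ := by gcongr
  have h4 := ENNReal.rpow_le_rpow h3 (show 0 ≤ 1 / p by positivity)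
  rwa [ENNReal.mul_rpow_of_nonneg _ _ (by positivity),
    ENNReal.mul_rpow_of_nonneg _ _ (by positivity),
    ENNReal.mul_rpow_of_nonneg _ _ (by positivity), ← ENNReal.rpow_mul, ← ENNReal.rpow_mul,
    mul_one_div_cancel hp0.ne', ENNReal.rpow_one, ENNReal.rpow_one, ← hCp] at h4

/-- The hypothesis gives `(φ(t) / φ(s)) ^ p ≤ K ^ p * (t / s) ^ (a * p)`, and `a * p < 1` makes the
right side integrable in `s`, with mean `K ^ p / (1 - a * p)` over `(0, t)`. -/
theorem fundamentalAverageBound_of_rpow_le (hna : IsDivisible μ) (hμ : μ univ ≠ 0) (hp : 1 ≤ p)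
    {a δ : ℝ} (ha : a < 1 / p) (hδ : 0 < δ) (K : ℝ≥0)
    (h : ∀ s t, 0 < s → s < t → t < δ →
      X.fundamental t * ENNReal.ofReal (s / t) ^ a ≤ K * X.fundamental s) :
    X.FundamentalAverageBound p := by
  have hp0 : 0 < p := by linarith
  have hap : a * p < 1 := by rwa [lt_div_iff₀ hp0] at ha
  have hr : -1 < -(a * p) := by linarith
  refine ⟨δ, hδ, K ^ p * (1 / (-(a * p) + 1)).toNNReal, fun t ht => ?_⟩
  have ht0 : ENNReal.ofReal t ≠ 0 := (ENNReal.ofReal_pos.2 ht.1).ne'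
  have hpt : ∀ s ∈ Ioo 0 t, X.fundamental t ^ p * X.fundamental s ^ (-p) ≤
      (K : ℝ≥0∞) ^ p * ENNReal.ofReal t ^ (a * p) * ENNReal.ofReal s ^ (-(a * p)) := by
    intro s hs
    have hs0 : ENNReal.ofReal s ≠ 0 := (ENNReal.ofReal_pos.2 hs.1).ne'
    have hφ0 := (fundamental_pos (X := X) hna hμ hs.1).ne'
    have hφ1 := (fundamental_lt_top (X := X) hna s).ne
    have h1 := ENNReal.rpow_le_rpow (h s t hs.1 hs.2 ht.2) hp0.le
    rw [ENNReal.mul_rpow_of_nonneg _ _ hp0.le, ENNReal.mul_rpow_of_nonneg _ _ hp0.le,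
      ← ENNReal.rpow_mul, ENNReal.ofReal_div_of_pos ht.1, div_eq_mul_inv,
      ENNReal.mul_rpow_of_ne_top ENNReal.ofReal_ne_top (by simpa using ht.1),
      ENNReal.inv_rpow] at h1
    set φt := X.fundamental t
    set φs := X.fundamental s
    have hS0 : ENNReal.ofReal s ^ (a * p) ≠ 0 := by
      rw [Ne, ENNReal.rpow_eq_zero_iff]; simp [hs0]
    have hS1 : ENNReal.ofReal s ^ (a * p) ≠ ∞ := by
      rw [Ne, ENNReal.rpow_eq_top_iff]; simp [hs0]
    have hT0 : ENNReal.ofReal t ^ (a * p) ≠ 0 := by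
      rw [Ne, ENNReal.rpow_eq_zero_iff]; simp [ht0]
    have hT1 : ENNReal.ofReal t ^ (a * p) ≠ ∞ := by
      rw [Ne, ENNReal.rpow_eq_top_iff]; simp [ht0]
    rw [ENNReal.rpow_neg, ENNReal.rpow_neg, ← div_eq_mul_inv, ← div_eq_mul_inv,
      ENNReal.div_le_iff (by simp [hφ0, hφ1]) (ENNReal.rpow_ne_top_of_nonneg hp0.le hφ1)]
    calc φt ^ p = φt ^ p * (ENNReal.ofReal s ^ (a * p) * (ENNReal.ofReal t ^ (a * p))⁻¹) *
          (ENNReal.ofReal t ^ (a * p) * (ENNReal.ofReal s ^ (a * p))⁻¹) := by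
          have e1 := ENNReal.mul_inv_cancel hS0 hS1
          have e2 := ENNReal.inv_mul_cancel hT0 hT1
          calc φt ^ p = φt ^ p * (ENNReal.ofReal s ^ (a * p) * (ENNReal.ofReal s ^ (a * p))⁻¹) *
                ((ENNReal.ofReal t ^ (a * p))⁻¹ * ENNReal.ofReal t ^ (a * p)) := by
                rw [e1, e2, mul_one, mul_one]
            _ = _ := by ring
      _ ≤ (K : ℝ≥0∞) ^ p * φs ^ p *
          (ENNReal.ofReal t ^ (a * p) * (ENNReal.ofReal s ^ (a * p))⁻¹) := by gcongr
      _ = _ := by rw [div_eq_mul_inv]; ring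
  have hmeas : Measurable fun s => X.fundamental s ^ (-p) := by
    have := (monotone_fundamental (X := X) hna).measurable
    fun_prop
  rw [setLAverage_eq, Real.volume_Ioo, sub_zero, ← mul_div_assoc,
    ENNReal.div_le_iff ht0 ENNReal.ofReal_ne_top, ← lintegral_const_mul _ hmeas]
  refine (setLIntegral_mono' measurableSet_Ioo hpt).trans_eq ?_
  rw [lintegral_const_mul _ (by fun_prop), lintegral_Ioo_rpow hr ht.1.le]
  have hden : 0 < -(a * p) + 1 := by linarith
  have e1 : ENNReal.ofReal (t ^ (-(a * p) + 1) / (-(a * p) + 1)) =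
      ENNReal.ofReal t ^ (-(a * p) + 1) * ENNReal.ofReal (1 / (-(a * p) + 1)) := by
    rw [div_eq_mul_one_div, ENNReal.ofReal_mul (Real.rpow_nonneg ht.1.le _),
      ENNReal.ofReal_rpow_of_pos ht.1]
  have e2 : ENNReal.ofReal t ^ (a * p) * ENNReal.ofReal t ^ (-(a * p) + 1) = ENNReal.ofReal t := by
    rw [← ENNReal.rpow_add _ _ ht0 ENNReal.ofReal_ne_top]
    simp
  rw [e1, ENNReal.coe_mul, ENNReal.coe_rpow_of_nonneg _ hp0.le]
  calc _ = (K : ℝ≥0∞) ^ p * (ENNReal.ofReal t ^ (a * p) * ENNReal.ofReal t ^ (-(a * p) + 1)) *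
        ENNReal.ofReal (1 / (-(a * p) + 1)) := by ring
    _ = _ := by rw [e2, ENNReal.ofReal, ENNReal.ofReal]; ring

/-- Concavity between `0`, where the value is nonnegative, and `t` gives `φ(s)^q ≥ (s / t) φ(t)^q`:
the power bound with `a = 1 / q`. -/
theorem fundamentalAverageBound_of_concaveOn (hna : IsDivisible μ) (hμ : μ univ ≠ 0)
    (hp : 1 ≤ p) {q δ : ℝ} (hpq : p < q) (hδ : 0 < δ)
    (h : ConcaveOn ℝ (Ico 0 δ) (fun t => (X.fundamental t).toReal ^ q)) :
    X.FundamentalAverageBound p := by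
  have hp0 : 0 < p := by linarith
  have hq0 : 0 < q := by linarith
  refine fundamentalAverageBound_of_rpow_le hna hμ hp (a := 1 / q)
    (one_div_lt_one_div_of_lt hp0 hpq) hδ 1 fun s t hs hst htδ => ?_
  have ht : 0 < t := hs.trans hst
  have hst0 : 0 ≤ s / t := by positivity
  have h1 := h.2 (show t ∈ Ico 0 δ from ⟨ht.le, htδ⟩) (show (0 : ℝ) ∈ Ico 0 δ from ⟨le_rfl, hδ⟩)
    hst0 (show 0 ≤ 1 - s / t by rw [sub_nonneg, div_le_one ht]; exact hst.le) (by ring)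
  simp only [smul_eq_mul, mul_zero, add_zero, div_mul_cancel₀ s ht.ne'] at h1
  have h2 : s / t * (X.fundamental t).toReal ^ q ≤ (X.fundamental s).toReal ^ q := by
    refine le_trans (le_add_of_nonneg_right (mul_nonneg ?_ (by positivity))) h1
    rw [sub_nonneg, div_le_one ht]; exact hst.le
  have h3 := Real.rpow_le_rpow (by positivity) h2 (show 0 ≤ 1 / q by positivity)
  rw [Real.mul_rpow hst0 (by positivity), ← Real.rpow_mul ENNReal.toReal_nonneg,
    ← Real.rpow_mul ENNReal.toReal_nonneg, mul_one_div_cancel hq0.ne', Real.rpow_one,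
    Real.rpow_one] at h3
  have h4 := ENNReal.ofReal_le_ofReal h3
  rwa [ENNReal.ofReal_mul (by positivity), ENNReal.ofReal_toReal (fundamental_lt_top hna _).ne,
    ENNReal.ofReal_toReal (fundamental_lt_top hna _).ne,
    ← ENNReal.ofReal_rpow_of_nonneg hst0 (by positivity), mul_comm, ← one_mul (X.fundamental s),
    ← ENNReal.coe_one] at h4

theorem fundamentalAverageBound_of_antitoneOn (hna : IsDivisible μ) (hμ : μ univ ≠ 0)
    (hp : 1 ≤ p) {q δ : ℝ} (hpq : p < q) (hδ : 0 < δ)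
    (h : AntitoneOn (fun t => X.fundamental t ^ q / ENNReal.ofReal t) (Ioo 0 δ)) :
    X.FundamentalAverageBound p := by
  have hp0 : 0 < p := by linarith
  have hq0 : 0 < q := by linarith
  refine fundamentalAverageBound_of_rpow_le hna hμ hp (a := 1 / q)
    (one_div_lt_one_div_of_lt hp0 hpq) hδ 1 fun s t hs hst htδ => ?_
  have ht : 0 < t := hs.trans hst
  have hs0 : ENNReal.ofReal s ≠ 0 := (ENNReal.ofReal_pos.2 hs).ne'
  have h1 := h ⟨hs, hst.trans htδ⟩ ⟨ht, htδ⟩ hst.le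
  simp only at h1
  rw [ENNReal.le_div_iff_mul_le (Or.inl hs0) (Or.inl ENNReal.ofReal_ne_top),
    ENNReal.mul_comm_div, ← ENNReal.ofReal_div_of_pos ht] at h1
  have h2 := ENNReal.rpow_le_rpow h1 (show 0 ≤ 1 / q by positivity)
  rwa [ENNReal.mul_rpow_of_nonneg _ _ (by positivity), ← ENNReal.rpow_mul, ← ENNReal.rpow_mul,
    mul_one_div_cancel hq0.ne', ENNReal.rpow_one, ENNReal.rpow_one, ← one_mul (X.fundamental s),
    ← ENNReal.coe_one] at h2

/-- Rescaling `(0, t)` to `(0, 1)` turns the mean into `∫_0^1 (φ(t) / φ(st))^p ds`, which the given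
integral dominates; that integral serves as the constant. -/
theorem fundamentalAverageBound_of_lintegral_lt_top (hna : IsDivisible μ) (hp : 1 ≤ p)
    (h : ∫⁻ s in Ioo (0 : ℝ) 1,
      (⨆ t ∈ Ioo (0 : ℝ) 1, X.fundamental t / X.fundamental (s * t)) ^ p < ∞) :
    X.FundamentalAverageBound p := by
  have hp0 : 0 < p := by linarith
  refine ⟨1, one_pos, _, fun t ht => le_trans ?_ (ENNReal.coe_toNNReal h.ne).ge⟩
  have ht0 : ENNReal.ofReal t ≠ 0 := (ENNReal.ofReal_pos.2 ht.1).ne'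
  have hmeas : Measurable fun s => X.fundamental s ^ (-p) := by
    have := (monotone_fundamental (X := X) hna).measurable
    fun_prop
  have hscale : ∫⁻ s in Ioo 0 t, X.fundamental s ^ (-p) =
      ENNReal.ofReal t * ∫⁻ s in Ioo 0 1, X.fundamental (s * t) ^ (-p) := by
    have hmap := Real.smul_map_volume_mul_right ht.1.ne'
    rw [abs_of_pos ht.1] at hmap
    conv_lhs => rw [← hmap]
    rw [Measure.restrict_smul, lintegral_smul_measure, smul_eq_mul,
      setLIntegral_map measurableSet_Ioo hmeas (by fun_prop)]
    congr 3
    ext s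
    simp only [mem_preimage, mem_Ioo]
    constructor
    · rintro ⟨h1, h2⟩
      exact ⟨(mul_pos_iff_of_pos_right ht.1).1 h1, by nlinarith [ht.1]⟩
    · rintro ⟨h1, h2⟩
      exact ⟨mul_pos h1 ht.1, by nlinarith [ht.1]⟩
  rw [setLAverage_eq, Real.volume_Ioo, sub_zero, hscale, mul_comm (ENNReal.ofReal t),
    ENNReal.mul_div_cancel_right ht0 ENNReal.ofReal_ne_top, ← lintegral_const_mul' _ _
      (ENNReal.rpow_ne_top_of_nonneg hp0.le (fundamental_lt_top hna t).ne)]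
  refine lintegral_mono fun s => ?_
  rw [ENNReal.rpow_neg, ← div_eq_mul_inv, ← ENNReal.div_rpow_of_nonneg _ _ hp0.le]
  refine ENNReal.rpow_le_rpow ?_ hp0.le
  exact le_iSup₂_of_le t ht le_rfl

/-- Some `s > 1` and `a < 1 / p` satisfy `φ(s t) ≤ s^a φ(t)` for all `t > 0`. Iterating along powers
of `s`, with monotonicity of `φ` in between, gives the power bound with `K = s^a`, the price of
rounding `t / r` up to a power of `s`. -/
theorem fundamentalAverageBound_of_upperFundamentalIndex (hna : IsDivisible μ)
    (hμ : μ univ ≠ 0) (hp : 1 ≤ p) (h : X.upperFundamentalIndex < ((1 / p : ℝ) : EReal)) :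
    X.FundamentalAverageBound p := by
  have hp0 : 0 < p := by linarith
  obtain ⟨s, hs⟩ := iInf_lt_iff.1 h
  obtain ⟨hs1, hs⟩ := iInf_lt_iff.1 hs
  have hlog : 0 < Real.log s := Real.log_pos hs1
  have hs0 : 0 < s := by linarith
  rw [EReal.div_lt_iff (by exact_mod_cast hlog) (EReal.coe_ne_top _), ← EReal.coe_mul] at hs
  obtain ⟨b, hb1, hb2⟩ := EReal.lt_iff_exists_real_btwn.1 hs
  rw [EReal.coe_lt_coe_iff] at hb2
  -- The maximum with `0` keeps the exponent nonnegative, so that `x ↦ x ^ a` is monotone.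
  set a : ℝ := max b 0 / Real.log s with ha
  have ha0 : 0 ≤ a := by positivity
  have hap : a < 1 / p := by
    rw [ha, div_lt_iff₀ hlog]
    exact max_lt hb2 (by positivity)
  have hsa : s ^ a = Real.exp (max b 0) := by
    rw [Real.rpow_def_of_pos hs0, ha, mul_div_cancel₀ _ hlog.ne']
  have hk : (⨆ (t : ℝ) (_ : 0 < t), X.fundamental (s * t) / X.fundamental t) ≤
      ENNReal.ofReal (s ^ a) := by
    have h1 : ENNReal.log (⨆ (t : ℝ) (_ : 0 < t), X.fundamental (s * t) / X.fundamental t) ≤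
        ENNReal.log (ENNReal.ofReal (s ^ a)) := by
      rw [ENNReal.log_ofReal_of_pos (by positivity), hsa, Real.log_exp]
      exact hb1.le.trans (EReal.coe_le_coe_iff.2 (le_max_left _ _))
    exact ENNReal.log_le_log_iff.1 h1
  have hstep : ∀ t, 0 < t → X.fundamental (s * t) ≤ ENNReal.ofReal (s ^ a) * X.fundamental t := by
    intro t ht
    rw [← ENNReal.div_le_iff (fundamental_pos hna hμ ht).ne' (fundamental_lt_top hna t).ne]
    exact le_trans (le_iSup₂_of_le t ht le_rfl) hk
  have hpow : ∀ (n : ℕ) t, 0 < t →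
      X.fundamental (s ^ n * t) ≤ ENNReal.ofReal ((s ^ a) ^ n) * X.fundamental t := by
    intro n
    induction n with
    | zero => intro t _; simp
    | succ n ih =>
      intro t ht
      calc X.fundamental (s ^ (n + 1) * t) = X.fundamental (s * (s ^ n * t)) := by ring_nf
        _ ≤ ENNReal.ofReal (s ^ a) * (ENNReal.ofReal ((s ^ a) ^ n) * X.fundamental t) :=
            (hstep _ (by positivity)).trans (mul_le_mul_right (ih t ht) _)
        _ = _ := by
            rw [← mul_assoc, ← ENNReal.ofReal_mul (by positivity), pow_succ' (s ^ a)]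
  refine fundamentalAverageBound_of_rpow_le hna hμ hp hap one_pos (s ^ a).toNNReal
    fun r t hr hrt _ => ?_
  have ht : 0 < t := hr.trans hrt
  obtain ⟨n, hn1, hn2⟩ := exists_nat_pow_near (x := t / r) ((one_le_div hr).2 hrt.le) hs1
  have h1 : X.fundamental t ≤ ENNReal.ofReal ((s ^ a) ^ (n + 1)) * X.fundamental r := by
    refine (monotone_fundamental hna ?_).trans (hpow (n + 1) r hr)
    rw [div_lt_iff₀ hr] at hn2
    exact hn2.le
  have h2 : (s ^ a) ^ (n + 1) * (r / t) ^ a ≤ s ^ a := by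
    have h3 : (s ^ a) ^ n ≤ (t / r) ^ a := by
      rw [← Real.rpow_natCast, ← Real.rpow_mul hs0.le, mul_comm, Real.rpow_mul hs0.le,
        Real.rpow_natCast]
      exact Real.rpow_le_rpow (by positivity) hn1 ha0
    have h4 : (t / r) ^ a * (r / t) ^ a = 1 := by
      rw [← Real.mul_rpow (by positivity) (by positivity), div_mul_div_comm, mul_comm t r,
        div_self (by positivity), Real.one_rpow]
    calc (s ^ a) ^ (n + 1) * (r / t) ^ a = s ^ a * ((s ^ a) ^ n * (r / t) ^ a) := by ring
      _ ≤ s ^ a * ((t / r) ^ a * (r / t) ^ a) := by gcongr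
      _ = s ^ a := by rw [h4, mul_one]
  calc X.fundamental t * ENNReal.ofReal (r / t) ^ a
      ≤ ENNReal.ofReal ((s ^ a) ^ (n + 1)) * X.fundamental r * ENNReal.ofReal (r / t) ^ a := by
        gcongr
    _ = ENNReal.ofReal ((s ^ a) ^ (n + 1) * (r / t) ^ a) * X.fundamental r := by
        rw [ENNReal.ofReal_mul (by positivity),
          ← ENNReal.ofReal_rpow_of_nonneg (show 0 ≤ r / t by positivity) ha0]
        ring
    _ ≤ ENNReal.ofReal (s ^ a) * X.fundamental r := by gcongr

theorem upperFundamentalIndex_le_upperBoydIndex (hna : IsDivisible μ) (hμ : μ univ ≠ 0) :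
    X.upperFundamentalIndex ≤ X.upperBoydIndex := by
  refine le_iInf₂ fun s hs => iInf₂_le_of_le (s : ℝ) hs ?_
  refine EReal.div_le_div_right_of_nonneg (by exact_mod_cast (Real.log_pos hs).le) ?_
  refine ENNReal.log_monotone (iSup₂_le fun t ht => ?_)
  exact fundamental_div_le_dilationNorm hna hμ s ht

end RISpace

end Conditions

end

theorem mainTheorem3 {P : Type*} [MetricSpace P] [MeasurableSpace P] [BorelSpace P]
    (μ : Measure P) (hball : BallsFinitePos μ) (hdoubling : IsDoubling μ) [NullSingletonClass μ]
    (p : ℝ) (hp : 1 ≤ p) (hPI : IsPoincareSpace μ p)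
    (X : RISpace μ) (hAC : X.HasACNorm)
    (h :
      Embeds μ X (marcinkiewiczLocNorm μ p X.fundamental) ∨
      EmbedsFm μ X (lambdaNorm μ p (quasiconcaveMajorant p X.fundamental)) ∨
      (EmbedsFm μ (lorentzNorm μ p 1) X ∧
        EmbedsFm μ X (fun f => eLpNorm f (ENNReal.ofReal p) μ)) ∨
      (∃ δ : ℝ, 0 < δ ∧ ∃ C : ℝ≥0, ∀ t ∈ Ioo 0 δ,
        X.fundamental t ^ p * (⨍⁻ s in Ioo 0 t, X.fundamental s ^ (-p) ∂volume) ≤ C) ∨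
      (∃ q δ : ℝ, p < q ∧ 0 < δ ∧
        ConcaveOn ℝ (Ico 0 δ) (fun t => (X.fundamental t).toReal ^ q)) ∨
      (∃ q δ : ℝ, p < q ∧ 0 < δ ∧
        AntitoneOn (fun t => X.fundamental t ^ q / ENNReal.ofReal t) (Ioo 0 δ)) ∨
      (∫⁻ s in Ioo (0 : ℝ) 1,
        (⨆ t ∈ Ioo (0 : ℝ) 1, X.fundamental t / X.fundamental (s * t)) ^ p) < ∞ ∨
      X.upperFundamentalIndex < ((1 / p : ℝ) : EReal) ∨
      X.upperBoydIndex < ((1 / p : ℝ) : EReal)) :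
    LipschitzDenseInNewtonian X := by
  have := hball.secondCountableTopology
  have := hball.sigmaFinite
  have hna : IsDivisible μ := fun _ hG _ hs => exists_subset_measure_eq hG hs
  suffices hW : X.ControlsLpMean p from
    hW.lipschitzDenseInNewtonian hball hdoubling hp hPI hAC
  -- For zero measure the control property is vacuous; otherwise `φ > 0` on `(0, ∞)`, which the
  -- quotients of `φ` below rely on.
  rcases eq_or_ne (μ univ) 0 with hμ | hμ
  · refine ⟨0, 1, one_pos, fun E f _ hpos => ?_⟩
    exact absurd (measure_mono_null (subset_univ E) hμ) hpos.ne'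
  rcases h with h | h | ⟨h₁, h₂⟩ | h | ⟨q, δ, hpq, hδ, h⟩ | ⟨q, δ, hpq, hδ, h⟩ | h | h | h
  · exact RISpace.controlsLpMean_of_marcinkiewicz hp h
  · exact RISpace.controlsLpMean_of_lambda hp h
  · exact RISpace.controlsLpMean_of_lorentz hp h₁ h₂
  · exact RISpace.FundamentalAverageBound.controlsLpMean hna hp h
  · exact (RISpace.fundamentalAverageBound_of_concaveOn hna hμ hp hpq hδ h).controlsLpMean hna hp
  · exact (RISpace.fundamentalAverageBound_of_antitoneOn hna hμ hp hpq hδ h).controlsLpMean hna hp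
  · exact (RISpace.fundamentalAverageBound_of_lintegral_lt_top hna hp h).controlsLpMean hna hp
  · exact (RISpace.fundamentalAverageBound_of_upperFundamentalIndex hna hμ hp h).controlsLpMean
      hna hp
  · exact (RISpace.fundamentalAverageBound_of_upperFundamentalIndex hna hμ hp
      ((RISpace.upperFundamentalIndex_le_upperBoydIndex hna hμ).trans_lt h)).controlsLpMean hna hp
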